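/- **Setting.** Fix a countably infinite multi-sorted set of names with infinitely many names of each occurring sort. Permutations $\pi$ are the sort-preserving bijections on names that fix all but finitely many names; $\operatorname{supp}$ denotes least finite support, $N\# x$ means $N\cap\operatorname{supp}(x)=\emptyset$, and $\langle N\rangle x$ is the alpha-equivalence class of $x$ with the finite set of names $N$ bound. A nominal transition system has nominal sets of states $P,Q$, state predicates $\varphi$ and actions $\alpha$, an equivariant relation $P\vdash\varphi$, an equivariant function $\operatorname{bn}$ with $\operatorname{bn}(\alpha)$ a finite subset of $\operatorname{supp}(\alpha)$, and an equivariant set of transitions $(P,\langle \operatorname{bn}(\alpha)\rangle(\alpha,P'))$, written $P\xrightarrow{\alpha}P'$. Assume moreover a special action $\tau$ with empty support. Let $\kappa$ be a cardinal with $\kappa>\aleph_0$ and $\kappa>|\mathrm{States}|$. $\Rightarrow$ is the reflexive transitive closure of $\xrightarrow{\tau}$; $P\stackrel{\hat\alpha}{\Rightarrow}P'$ means $P\Rightarrow P'$ if $\alpha=\tau$, and $P\Rightarrow\xrightarrow{\alpha}\Rightarrow P'$ otherwise. A weak bisimulation is a symmetric relation $R$ on states such that $R(P,Q)$ implies: (i)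 if $P\xrightarrow{\alpha}P'$ and $\operatorname{bn}(\alpha)\#Q$, then there is $Q'$ with $Q\stackrel{\hat\alpha}{\Rightarrow}Q'$ and $R(P',Q')$; (ii) if $P\vdash\varphi$, then there is $Q'$ with $Q\Rightarrow Q'$, $Q'\vdash\varphi$ and $R(P,Q')$. Weak bisimilarity $\stackrel{\cdot}{\approx}$ is the union of all weak bisimulations. Formulas are $A::=\bigwedge_{i\in I} A_i\mid\neg A\mid\varphi\mid\langle\alpha\rangle A$, where a conjunction is of a set of formulas $\{A_i\mid i\in I\}$ that has finite support and cardinality less than $\kappa$ (call such a set *well-formed*), and the names $\operatorname{bn}(\alpha)$ are bound in $\langle\alpha\rangle A$ (formulas are taken up to alpha-equivalence). Validity $P\models A$ is defined as usual; $P\models\langle\alpha\rangle A$ holds if, for a representative with $\operatorname{bn}(\alpha)\#P$, there is $P'$ with $P\xrightarrow{\alpha}P'$ and $P'\models A$. Put $\bigvee_{i} A_i=\neg\bigwedge_{i}\neg A_i$, $\langle\!\langle\tau\rangle\!\rangle A=\bigvee_{i\in\omega}\langle\tau\rangle^iA$ and $\langle\!\langle\alpha\rangle\!\rangle A=\langle\!\langle\tau\rangle\!\rangle\langle\alpha\rangle\langle\!\langle\tau\rangle\!\rangle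 A$ for $\alpha\ne\tau$. The weak formulas are those given by $A::=\bigwedge_{i\in I} A_i\mid\neg A\mid\langle\!\langle\alpha\rangle\!\rangle A\mid\langle\!\langle\tau\rangle\!\rangle(A\wedge\varphi)$. Write $P\stackrel{\cdot}{\equiv}Q$ if $P$ and $Q$ satisfy the same weak formulas. A characteristic weak formula for $P$ is a weak formula $A$ such that for all $Q$: $P\stackrel{\cdot}{\approx}Q$ iff $Q\models A$. **Theorem (Weak Expressive Completeness).** There is a function $B$ that assigns to any two states $P\not\stackrel{\cdot}{\equiv}Q$ a weak formula $B_{P,Q}$ with $P\models B_{P,Q}$, $Q\not\models B_{P,Q}$ and $\operatorname{supp}(B_{P,Q})\subseteq\operatorname{supp}(P)$. For every such $B$, the conjunctions $$D(P,Q)=\bigwedge_\pi\pi^{-1}\cdot B_{\pi\cdot P,\pi\cdot Q}\quad(P\not\stackrel{\cdot}{\equiv}Q),\qquad \mathrm{Char}(P)=\bigwedge_{Q\,:\,P\not\stackrel{\cdot}{\equiv}Q}D(P,Q)$$ are over well-formed sets, and $\mathrm{Char}(P)$ is a characteristic weak formula for $P$. Moreover, for every finitely supported set $S$ of states that is closed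 under weak bisimilarity (if $P\in S$ and $P\stackrel{\cdot}{\approx}Q$, then $Q\in S$), the set $\{\mathrm{Char}(P')\mid P'\in S\}$ is well-formed, $\bigvee_{P'\in S}\mathrm{Char}(P')$ is a weak formula, and for all states $P$ $$P\in S\quad\text{iff}\quad P\models\bigvee_{P'\in S}\mathrm{Char}(P').$$ -/

import Mathlib

open scoped Pointwise Cardinal

universe u

namespace NomTS

/-- A countably infinite multi-sorted set of names: every name has a sort, and there are infinitely
many names of the sort of any given name. -/
class Names (𝒩 : Type u) where
  Srt : Type u
  srt : 𝒩 → Srt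
  countable : Countable 𝒩
  nonempty : Nonempty 𝒩
  infinite_sort : ∀ a : 𝒩, {b : 𝒩 | srt b = srt a}.Infinite

/-- The group of sort-preserving bijections that fix all but finitely many names. -/
def namePerms (𝒩 : Type u) [Names 𝒩] : Subgroup (Equiv.Perm 𝒩) where
  carrier := {π | {a | π a ≠ a}.Finite ∧ ∀ a, Names.srt (π a) = Names.srt a}
  one_mem' := by simp
  mul_mem' := by
    rintro π ρ ⟨h1, h2⟩ ⟨h3, h4⟩
    refine ⟨(h1.union h3).subset ?_, fun a => by simp [h2, h4]⟩
    intro a ha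
    by_contra hc
    simp only [Set.mem_union, Set.mem_ofPred_eq, not_or, not_not] at hc ha
    exact ha (by simp [Equiv.Perm.mul_apply, hc.1, hc.2])
  inv_mem' := by
    rintro π ⟨h1, h2⟩
    refine ⟨h1.subset ?_, fun a => ?_⟩
    · intro a ha hc
      exact ha (by rw [Equiv.Perm.inv_eq_iff_eq]; exact hc.symm)
    · have h := h2 (π⁻¹ a)
      simpa using h.symm

/-- Permutations of names. They act on names by application. -/
abbrev NPerm (𝒩 : Type u) [Names 𝒩] : Type u := ↥(namePerms 𝒩)

section Support

variable (𝒩 : Type u) [Names 𝒩] {X : Type u} [MulAction (NPerm 𝒩) X]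

/-- Some finite set of names supports `x`. -/
def FinSupp (x : X) : Prop :=
  ∃ N : Set 𝒩, N.Finite ∧ MulAction.Supports (NPerm 𝒩) N x

/-- The least finite set of names that supports `x` (if `x` is finitely supported). -/
def supp (x : X) : Set 𝒩 :=
  {a | ∀ N : Set 𝒩, N.Finite → MulAction.Supports (NPerm 𝒩) N x → a ∈ N}

variable {𝒩}

/-- `N # x`: all names in `N` are fresh for `x`. -/
def Fresh (N : Finset 𝒩) (x : X) : Prop := ∀ a ∈ N, a ∉ supp 𝒩 x

/-- The permutation action on finite sets of names. -/
def permFinset (π : NPerm 𝒩) (N : Finset 𝒩) : Finset 𝒩 :=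
  N.map (π : Equiv.Perm 𝒩).toEmbedding

theorem mem_permFinset (π : NPerm 𝒩) (N : Finset 𝒩) (a : 𝒩) :
    a ∈ permFinset π N ↔ π⁻¹ • a ∈ N := by
  simp only [permFinset, Finset.mem_map]
  constructor
  · rintro ⟨b, hb, rfl⟩
    change π⁻¹ • (π • b) ∈ N
    rwa [inv_smul_smul]
  · intro h
    exact ⟨_, h, smul_inv_smul π a⟩

theorem supports_smul {N : Set 𝒩} {x : X} (π : NPerm 𝒩)
    (h : MulAction.Supports (NPerm 𝒩) N x) :
    MulAction.Supports (NPerm 𝒩) (π • N) (π • x) := by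
  intro ρ hρ
  have h1 : (π⁻¹ * ρ * π) • x = x := by
    apply h
    intro a ha
    have h2 : ρ • (π • a) = π • a := hρ (Set.smul_mem_smul_set ha)
    rw [mul_smul, mul_smul, h2, inv_smul_smul]
  rw [mul_smul, mul_smul, inv_smul_eq_iff] at h1
  exact h1

theorem finSupp_smul {x : X} (π : NPerm 𝒩) (h : FinSupp 𝒩 x) : FinSupp 𝒩 (π • x) := by
  obtain ⟨N, hN, hs⟩ := h
  exact ⟨π • N, hN.smul_set, supports_smul π hs⟩

theorem mem_supp_smul {x : X} {π : NPerm 𝒩} {a : 𝒩} (h : a ∈ supp 𝒩 (π • x)) :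
    π⁻¹ • a ∈ supp 𝒩 x := fun N hN hs =>
  Set.mem_smul_set_iff_inv_smul_mem.1 (h (π • N) hN.smul_set (supports_smul π hs))

theorem smul_mem_supp {x : X} {π : NPerm 𝒩} {a : 𝒩} (h : a ∈ supp 𝒩 x) :
    π • a ∈ supp 𝒩 (π • x) := by
  have h1 : a ∈ supp 𝒩 (π⁻¹ • (π • x)) := by rwa [inv_smul_smul]
  simpa using mem_supp_smul h1

end Support

/-- A nominal set: a set with an action of the name permutations in which every element is
finitely supported. -/
class Nominal (𝒩 : Type u) [Names 𝒩] (X : Type u) extends MulAction (NPerm 𝒩) X where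
  finSupp : ∀ x : X, FinSupp 𝒩 x

section Abstraction

variable (𝒩 : Type u) [Names 𝒩] (X : Type u) [MulAction (NPerm 𝒩) X]

/-- Nominal alpha-equivalence on pairs of a finite set of names and an object. -/
def absSetoid : Setoid (Finset 𝒩 × X) where
  r p q := ∃ π : NPerm 𝒩, permFinset π p.1 = q.1 ∧ π • p.2 = q.2 ∧
    ∀ a ∈ supp 𝒩 p.2, a ∉ p.1 → π • a = a
  iseqv := by
    refine ⟨fun p => ⟨1, ?_, one_smul _ _, fun a _ _ => one_smul _ a⟩, ?_, ?_⟩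
    · ext a; simp [mem_permFinset]
    · rintro ⟨N, x⟩ ⟨M, y⟩ ⟨π, h1, h2, h3⟩
      dsimp only at h1 h2 h3 ⊢
      subst h1 h2
      refine ⟨π⁻¹, ?_, inv_smul_smul _ _, fun a ha hN => ?_⟩
      · ext a; simp [mem_permFinset]
      · rw [mem_permFinset] at hN
        have h4 := h3 _ (mem_supp_smul ha) hN
        rw [smul_inv_smul] at h4
        exact h4.symm
    · rintro ⟨N, x⟩ ⟨M, y⟩ ⟨K, z⟩ ⟨π, h1, h2, h3⟩ ⟨ρ, h4, h5, h6⟩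
      dsimp only at h1 h2 h3 h4 h5 h6 ⊢
      subst h1 h2 h4 h5
      refine ⟨ρ * π, ?_, mul_smul _ _ _, fun a ha hN => ?_⟩
      · ext a; simp [mem_permFinset, mul_smul]
      · have h7 := h3 a ha hN
        have h8 : ρ • (π • a) = π • a :=
          h6 _ (smul_mem_supp ha) (by rwa [mem_permFinset, inv_smul_smul])
        rw [mul_smul, h8, h7]

/-- The set of alpha-equivalence classes. -/
def NameAbs : Type u := Quotient (absSetoid 𝒩 X)

variable {𝒩 X}

/-- The class `⟨N⟩x`. -/
def NameAbs.mk (N : Finset 𝒩) (x : X) : NameAbs 𝒩 X := Quotient.mk (absSetoid 𝒩 X) (N, x)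

end Abstraction

/-- Nominal transition systems. -/
structure NTS (𝒩 : Type u) [Names 𝒩] (State Pred Act : Type u)
    [Nominal 𝒩 State] [Nominal 𝒩 Pred] [Nominal 𝒩 Act] where
  entails : State → Pred → Prop
  entails_smul : ∀ (π : NPerm 𝒩) P φ, entails P φ → entails (π • P) (π • φ)
  bn : Act → Finset 𝒩
  bn_smul : ∀ (π : NPerm 𝒩) α, bn (π • α) = permFinset π (bn α)
  bn_subset : ∀ α, ∀ a ∈ bn α, a ∈ supp 𝒩 α
  /-- the transition relation, between states and residuals -/
  tr : Set (State × NameAbs 𝒩 (Act × State))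
  tr_smul : ∀ (π : NPerm 𝒩) P N α Q, (P, NameAbs.mk N (α, Q)) ∈ tr →
    (π • P, NameAbs.mk (permFinset π N) (π • α, π • Q)) ∈ tr
  tr_bn : ∀ P N α Q, (P, NameAbs.mk N (α, Q)) ∈ tr → bn α = N

/-- Nominal transition systems with an unobservable action of empty support. -/
structure WeakNTS (𝒩 : Type u) [Names 𝒩] (State Pred Act : Type u)
    [Nominal 𝒩 State] [Nominal 𝒩 Pred] [Nominal 𝒩 Act] extends NTS 𝒩 State Pred Act where
  τ : Act
  τ_smul : ∀ π : NPerm 𝒩, π • τ = τ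

/-! ### Raw formulas and alpha-equivalence -/

/-- Raw formulas, in which binding names are not abstracted. A conjunction is indexed by a set of
cardinality less than `κ` (up to bijection, a subset of a fixed set of cardinality `κ`). -/
inductive Raw (Pred Act : Type u) (κ : Cardinal.{u}) : Type u
  | conj (I : Set κ.out) (hI : #I < κ) (R : I → Raw Pred Act κ)
  | neg (R : Raw Pred Act κ)
  | pred (φ : Pred)
  | may (α : Act) (R : Raw Pred Act κ)

section Formulas

variable {𝒩 : Type u} [Names 𝒩] {State Pred Act : Type u}
  [Nominal 𝒩 State] [Nominal 𝒩 Pred] [Nominal 𝒩 Act]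

namespace Raw

variable {κ : Cardinal.{u}}

/-- Permutations distribute over all constructors. -/
def perm (π : NPerm 𝒩) : Raw Pred Act κ → Raw Pred Act κ
  | conj I hI R => conj I hI (fun i => perm π (R i))
  | neg R => neg (perm π R)
  | pred φ => pred (π • φ)
  | may α R => may (π • α) (perm π R)

instance : MulAction (NPerm 𝒩) (Raw Pred Act κ) where
  smul := perm
  one_smul R := by
    change perm 1 R = R
    induction R with
    | conj I hI R ih => simp only [perm, ih]
    | neg R ih => simp only [perm, ih]
    | pred φ => simp only [perm, one_smul]
    | may α R ih => simp only [perm, ih, one_smul]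
  mul_smul π ρ R := by
    change perm (π * ρ) R = perm π (perm ρ R)
    induction R with
    | conj I hI R ih => simp only [perm, ih]
    | neg R ih => simp only [perm, ih]
    | pred φ => simp only [perm, mul_smul]
    | may α R ih => simp only [perm, ih, mul_smul]

theorem smul_conj (π : NPerm 𝒩) (I : Set κ.out) (hI) (R : I → Raw Pred Act κ) :
    π • conj I hI R = conj I hI (fun i => π • R i) := rfl
theorem smul_neg (π : NPerm 𝒩) (R : Raw Pred Act κ) : π • neg R = neg (π • R) := rfl
theorem smul_pred (π : NPerm 𝒩) (φ : Pred) :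
    π • (pred φ : Raw Pred Act κ) = pred (π • φ) := rfl
theorem smul_may (π : NPerm 𝒩) (α : Act) (R : Raw Pred Act κ) :
    π • may α R = may (π • α) (π • R) := rfl

/-- Alpha-equivalence of raw formulas. In the last case, `π • R` and `S` are to be
alpha-equivalent (written as `R` and `π⁻¹ • S`, so that the recursion is structural), and `π` fixes
all names in the supports of `α` and of the alpha-equivalence class of `R`, except the binding
names of `α`. -/
def Alpha (T : NTS 𝒩 State Pred Act) : Raw Pred Act κ → Raw Pred Act κ → Prop
  | conj _ _ R, conj _ _ S =>
      (∀ i, ∃ j, Alpha T (R i) (S j)) ∧ (∀ j, ∃ i, Alpha T (R i) (S j))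
  | neg R, neg S => Alpha T R S
  | pred φ, pred ψ => φ = ψ
  | may α R, may β S => ∃ π : NPerm 𝒩, π • α = β ∧ Alpha T R (π⁻¹ • S) ∧
      ∀ a : 𝒩, (a ∈ supp 𝒩 α ∨
          ∀ N : Set 𝒩, N.Finite →
            (∀ ρ : NPerm 𝒩, (∀ b ∈ N, ρ • b = b) → Alpha T R (ρ • R)) → a ∈ N) →
        a ∉ T.bn α → π • a = a
  | _, _ => False

variable (T : NTS 𝒩 State Pred Act)

/-- The support of the alpha-equivalence class of a raw formula. -/
def asupp (R : Raw Pred Act κ) : Set 𝒩 :=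
  {a | ∀ N : Set 𝒩, N.Finite →
    (∀ ρ : NPerm 𝒩, (∀ b ∈ N, ρ • b = b) → Alpha T R (ρ • R)) → a ∈ N}

theorem alpha_may_iff {α β : Act} {R S : Raw Pred Act κ} :
    Alpha T (may α R) (may β S) ↔ ∃ π : NPerm 𝒩, π • α = β ∧ Alpha T R (π⁻¹ • S) ∧
      ∀ a : 𝒩, (a ∈ supp 𝒩 α ∨ a ∈ asupp T R) → a ∉ T.bn α → π • a = a := by
  rw [Alpha]; rfl

theorem alpha_refl (R : Raw Pred Act κ) : Alpha T R R := by
  induction R with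
  | conj I hI R ih => rw [Alpha]; exact ⟨fun i => ⟨i, ih i⟩, fun i => ⟨i, ih i⟩⟩
  | neg R ih => rwa [Alpha]
  | pred φ => rw [Alpha]
  | may α R ih =>
    rw [alpha_may_iff]
    exact ⟨1, one_smul _ _, by simpa using ih, fun a _ _ => one_smul _ a⟩

theorem alpha_smul (σ : NPerm 𝒩) (R S : Raw Pred Act κ) (h : Alpha T R S) :
    Alpha T (σ • R) (σ • S) := by
  induction R generalizing S σ with
  | conj I hI R ih =>
    cases S <;> simp only [Alpha] at h
    rw [smul_conj, smul_conj, Alpha]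
    refine ⟨fun i => ?_, fun j => ?_⟩
    · obtain ⟨j, hj⟩ := h.1 i; exact ⟨j, ih _ _ _ hj⟩
    · obtain ⟨i, hi⟩ := h.2 j; exact ⟨i, ih _ _ _ hi⟩
  | neg R ih =>
    cases S <;> simp only [Alpha] at h
    rw [smul_neg, smul_neg, Alpha]; exact ih _ _ h
  | pred φ =>
    cases S <;> simp only [Alpha] at h
    rw [h]; exact alpha_refl T _
  | may α R ih =>
    cases S with
    | may β S =>
      rw [alpha_may_iff] at h
      obtain ⟨π, rfl, h2, h3⟩ := h
      rw [smul_may, smul_may, alpha_may_iff]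
      refine ⟨σ * π * σ⁻¹, by simp [mul_smul], ?_, ?_⟩
      · have := ih σ _ h2
        simpa [mul_smul, mul_assoc] using this
      · intro a ha hb
        have hb' : σ⁻¹ • a ∉ T.bn α := by rwa [T.bn_smul, mem_permFinset] at hb
        have ha' : σ⁻¹ • a ∈ supp 𝒩 α ∨ σ⁻¹ • a ∈ asupp T R := by
          refine ha.imp mem_supp_smul fun h N hN hs => ?_
          refine Set.mem_smul_set_iff_inv_smul_mem.1 (h (σ • N) hN.smul_set fun ρ hρ => ?_)
          have h5 := hs (σ⁻¹ * ρ * σ) (fun b hb => by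
            rw [mul_smul, mul_smul, hρ _ (Set.smul_mem_smul_set hb), inv_smul_smul])
          simpa [mul_smul] using ih σ _ h5
        rw [mul_smul, mul_smul, h3 _ ha' hb', smul_inv_smul]
    | _ => simp only [Alpha] at h

theorem alpha_eucl_trans (R : Raw Pred Act κ) :
    (∀ S U, Alpha T R S → Alpha T R U → Alpha T S U) ∧
    (∀ S U, Alpha T R S → Alpha T S U → Alpha T R U) := by
  induction R with
  | conj I hI R ih =>
    refine ⟨fun S U h1 h2 => ?_, fun S U h1 h2 => ?_⟩
    · cases S <;> simp only [Alpha] at h1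
      cases U <;> simp only [Alpha] at h2
      rw [Alpha]
      refine ⟨fun i => ?_, fun j => ?_⟩
      · obtain ⟨k, hk⟩ := h1.2 i
        obtain ⟨j, hj⟩ := h2.1 k
        exact ⟨j, (ih k).1 _ _ hk hj⟩
      · obtain ⟨k, hk⟩ := h2.2 j
        obtain ⟨i, hi⟩ := h1.1 k
        exact ⟨i, (ih k).1 _ _ hi hk⟩
    · cases S <;> simp only [Alpha] at h1
      cases U <;> simp only [Alpha] at h2
      rw [Alpha]
      refine ⟨fun i => ?_, fun j => ?_⟩
      · obtain ⟨k, hk⟩ := h1.1 i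
        obtain ⟨j, hj⟩ := h2.1 k
        exact ⟨j, (ih i).2 _ _ hk hj⟩
      · obtain ⟨k, hk⟩ := h2.2 j
        obtain ⟨i, hi⟩ := h1.2 k
        exact ⟨i, (ih i).2 _ _ hi hk⟩
  | neg R ih =>
    refine ⟨fun S U h1 h2 => ?_, fun S U h1 h2 => ?_⟩
    · cases S <;> simp only [Alpha] at h1
      cases U <;> simp only [Alpha] at h2
      rw [Alpha]; exact ih.1 _ _ h1 h2
    · cases S <;> simp only [Alpha] at h1
      cases U <;> simp only [Alpha] at h2
      rw [Alpha]; exact ih.2 _ _ h1 h2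
  | pred φ =>
    refine ⟨fun S U h1 h2 => ?_, fun S U h1 h2 => ?_⟩
    · cases S <;> simp only [Alpha] at h1
      cases U <;> simp only [Alpha] at h2
      rw [Alpha]; exact h1.symm.trans h2
    · cases S <;> simp only [Alpha] at h1
      cases U <;> simp only [Alpha] at h2
      rw [Alpha]; exact h1.trans h2
  | may α R ih =>
    refine ⟨fun S U h1 h2 => ?_, fun S U h1 h2 => ?_⟩
    · cases S <;> try (simp only [Alpha] at h1; done)
      cases U <;> try (simp only [Alpha] at h2; done)
      rename_i β S γ U
      rw [alpha_may_iff] at h1 h2 ⊢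
      obtain ⟨π, rfl, h1, h1'⟩ := h1
      obtain ⟨ρ, rfl, h2, h2'⟩ := h2
      refine ⟨ρ * π⁻¹, by simp [mul_smul], ?_, ?_⟩
      · simpa [mul_smul] using alpha_smul T π _ _ (ih.1 _ _ h1 h2)
      · intro a ha hb
        have hb' : π⁻¹ • a ∉ T.bn α := by rwa [T.bn_smul, mem_permFinset] at hb
        have ha' : π⁻¹ • a ∈ supp 𝒩 α ∨ π⁻¹ • a ∈ asupp T R := by
          refine ha.imp mem_supp_smul fun h N hN hs => ?_
          refine Set.mem_smul_set_iff_inv_smul_mem.1 (h (π • N) hN.smul_set fun σ hσ => ?_)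
          have h5 := hs (π⁻¹ * σ * π) (fun b hb => by
            rw [mul_smul, mul_smul, hσ _ (Set.smul_mem_smul_set hb), inv_smul_smul])
          have h6 := ih.2 _ _ h5 (alpha_smul T (π⁻¹ * σ * π) _ _ h1)
          simpa [mul_smul] using alpha_smul T π _ _ (ih.1 _ _ h1 h6)
        have e1 := h1' _ ha' hb'
        have e2 := h2' _ ha' hb'
        rw [smul_inv_smul] at e1
        rw [mul_smul, e2, ← e1]
    · cases S <;> try (simp only [Alpha] at h1; done)
      cases U <;> try (simp only [Alpha] at h2; done)
      rename_i β S γ U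
      rw [alpha_may_iff] at h1 h2 ⊢
      obtain ⟨π, rfl, h1, h1'⟩ := h1
      obtain ⟨ρ, rfl, h2, h2'⟩ := h2
      refine ⟨ρ * π, by simp [mul_smul], ?_, ?_⟩
      · have := ih.2 _ _ h1 (alpha_smul T π⁻¹ _ _ h2)
        simpa [mul_smul] using this
      · intro a ha hb
        have e1 := h1' a ha hb
        have hb' : π • a ∉ T.bn (π • α) := by
          rwa [T.bn_smul, mem_permFinset, inv_smul_smul]
        have ha' : π • a ∈ supp 𝒩 (π • α) ∨ π • a ∈ asupp T S := by
          refine ha.imp smul_mem_supp fun h N hN hs => ?_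
          have key : a ∈ π⁻¹ • N := h (π⁻¹ • N) hN.smul_set fun σ hσ => by
            have h5 := hs (π * σ * π⁻¹) (fun b hb => by
              rw [mul_smul, mul_smul, hσ _ (Set.smul_mem_smul_set hb), smul_inv_smul])
            have h6 := alpha_smul T π⁻¹ _ _ h5
            have h7 : Alpha T R (σ • π⁻¹ • S) := by
              refine ih.2 _ _ h1 ?_
              simpa [mul_smul] using h6
            have h8 := alpha_smul T σ _ _ (ih.1 _ _ h1 (alpha_refl T R))
            exact ih.2 _ _ h7 h8
          rw [Set.mem_smul_set_iff_inv_smul_mem, inv_inv] at key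
          exact key
        rw [mul_smul, h2' _ ha' hb', e1]

/-- Alpha-equivalence as an equivalence relation. -/
def alphaSetoid (κ : Cardinal.{u}) : Setoid (Raw Pred Act κ) where
  r := Alpha T
  iseqv :=
    ⟨alpha_refl T, fun {R _} h => (alpha_eucl_trans T R).1 _ _ h (alpha_refl T R),
      fun {R _ _} h1 h2 => (alpha_eucl_trans T R).2 _ _ h1 h2⟩

end Raw

/-! ### Formulas -/

/-- Alpha-equivalence classes of raw formulas. -/
def AlphaClass (T : NTS 𝒩 State Pred Act) (κ : Cardinal.{u}) : Type u :=
  Quotient (Raw.alphaSetoid T κ)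

variable {T : NTS 𝒩 State Pred Act} {κ : Cardinal.{u}}

namespace AlphaClass

def mk (R : Raw Pred Act κ) : AlphaClass T κ := Quotient.mk (Raw.alphaSetoid T κ) R

/-- A representative. -/
noncomputable def rep (A : AlphaClass T κ) : Raw Pred Act κ := Quotient.out A

theorem mk_rep (A : AlphaClass T κ) : mk A.rep = A := Quotient.out_eq A

theorem mk_eq_mk {R S : Raw Pred Act κ} :
    (mk R : AlphaClass T κ) = mk S ↔ Raw.Alpha T R S :=
  Quotient.eq (r := Raw.alphaSetoid T κ)

theorem alpha_rep (R : Raw Pred Act κ) : Raw.Alpha T (mk R : AlphaClass T κ).rep R :=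
  mk_eq_mk.1 (mk_rep _)

instance : MulAction (NPerm 𝒩) (AlphaClass T κ) where
  smul π := Quotient.map (fun R => π • R) (fun _ _ h => Raw.alpha_smul T π _ _ h)
  one_smul A := by
    induction A using Quotient.inductionOn with
    | h R => exact congrArg mk (one_smul (NPerm 𝒩) R)
  mul_smul π ρ A := by
    induction A using Quotient.inductionOn with
    | h R => exact congrArg mk (mul_smul π ρ R)

theorem smul_mk (π : NPerm 𝒩) (R : Raw Pred Act κ) :
    π • (mk R : AlphaClass T κ) = mk (π • R) := rfl

noncomputable def conj (I : Set κ.out) (hI : #I < κ) (A : I → AlphaClass T κ) :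
    AlphaClass T κ := mk (Raw.conj I hI fun i => (A i).rep)

noncomputable def neg (A : AlphaClass T κ) : AlphaClass T κ := mk (Raw.neg A.rep)

def pred (φ : Pred) : AlphaClass T κ := mk (Raw.pred φ)

noncomputable def may (α : Act) (A : AlphaClass T κ) : AlphaClass T κ := mk (Raw.may α A.rep)

theorem alpha_smul_rep (π : NPerm 𝒩) (A : AlphaClass T κ) :
    Raw.Alpha T (π • A.rep) (π • A).rep := by
  rw [← mk_eq_mk (T := T), ← smul_mk, mk_rep, mk_rep]

theorem smul_conj (π : NPerm 𝒩) (I : Set κ.out) (hI : #I < κ) (A : I → AlphaClass T κ) :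
    π • conj I hI A = conj I hI (fun i => π • A i) := by
  rw [conj, smul_mk, conj, mk_eq_mk, Raw.smul_conj, Raw.Alpha]
  exact ⟨fun i => ⟨i, alpha_smul_rep π _⟩, fun i => ⟨i, alpha_smul_rep π _⟩⟩

theorem smul_neg (π : NPerm 𝒩) (A : AlphaClass T κ) : π • neg A = neg (π • A) := by
  rw [neg, smul_mk, neg, mk_eq_mk, Raw.smul_neg, Raw.Alpha]
  exact alpha_smul_rep π A

theorem smul_pred (π : NPerm 𝒩) (φ : Pred) :
    π • (pred φ : AlphaClass T κ) = pred (π • φ) := rfl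

theorem smul_may (π : NPerm 𝒩) (α : Act) (A : AlphaClass T κ) :
    π • may α A = may (π • α) (π • A) := by
  rw [may, smul_mk, may, mk_eq_mk, Raw.smul_may, Raw.alpha_may_iff]
  exact ⟨1, one_smul _ _, by simpa using alpha_smul_rep π A, fun a _ _ => one_smul _ a⟩

end AlphaClass

/-- Which alpha-equivalence classes are formulas: every conjunction, at any depth, is over a
finitely supported set of formulas. -/
inductive IsFormula : AlphaClass T κ → Prop
  | conj (I : Set κ.out) (hI : #I < κ) (A : I → AlphaClass T κ) (hA : ∀ i, IsFormula (A i))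
      (hs : FinSupp 𝒩 (Set.range A)) : IsFormula (AlphaClass.conj I hI A)
  | neg (A : AlphaClass T κ) (hA : IsFormula A) : IsFormula (AlphaClass.neg A)
  | pred (φ : Pred) : IsFormula (AlphaClass.pred φ)
  | may (α : Act) (A : AlphaClass T κ) (hA : IsFormula A) : IsFormula (AlphaClass.may α A)

theorem IsFormula.smul (π : NPerm 𝒩) {A : AlphaClass T κ} (h : IsFormula A) :
    IsFormula (π • A) := by
  induction h with
  | conj I hI A hA hs ih =>
    rw [AlphaClass.smul_conj]
    refine .conj I hI _ ih ?_
    have := finSupp_smul π hs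
    rwa [← Set.image_smul, ← Set.range_comp] at this
  | neg A hA ih => rw [AlphaClass.smul_neg]; exact .neg _ ih
  | pred φ => exact .pred _
  | may α A hA ih => rw [AlphaClass.smul_may]; exact .may _ _ ih

variable (T κ) in
/-- The nominal set of formulas over `T`, with conjunctions of fewer than `κ` formulas. -/
@[ext]
structure Formula : Type u where
  val : AlphaClass T κ
  isFormula : IsFormula val

namespace Formula

instance : MulAction (NPerm 𝒩) (Formula T κ) where
  smul π A := ⟨π • A.1, A.2.smul π⟩
  one_smul A := Formula.ext (one_smul _ A.1)
  mul_smul π ρ A := Formula.ext (mul_smul π ρ A.1)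

theorem smul_val (π : NPerm 𝒩) (A : Formula T κ) : (π • A).1 = π • A.1 := rfl

/-- The conjunction of a set of formulas is well-formed: the set has bounded cardinality and
finite support. -/
def WF (C : Set (Formula T κ)) : Prop := #C < κ ∧ FinSupp 𝒩 C

/-- A bijection between a set of cardinality less than `κ` and a subset of the index set. -/
theorem exists_index {C : Set (Formula T κ)} (h : #C < κ) :
    ∃ I : Set κ.out, Nonempty (I ≃ C) := by
  have h1 : #C ≤ #κ.out := by rw [Cardinal.mk_out]; exact h.le
  obtain ⟨e⟩ := Cardinal.le_def _ _ |>.1 h1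
  exact ⟨Set.range e, ⟨(Equiv.ofInjective e e.injective).symm⟩⟩

/-- The conjunction of a well-formed set of formulas. -/
noncomputable def conj (C : Set (Formula T κ)) (h : WF C) : Formula T κ :=
  let e := (exists_index h.1).choose_spec.some
  ⟨AlphaClass.conj (exists_index h.1).choose ((Cardinal.mk_congr e).trans_lt h.1)
      (fun i => (e i).1.1), by
    refine .conj _ _ _ (fun i => (e i).1.2) ?_
    obtain ⟨N, hN, hs⟩ := h.2
    refine ⟨N, hN, fun π hπ => ?_⟩
    have h1 : Set.range (fun i => (e i).1.1) = Formula.val '' C := by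
      ext A
      constructor
      · rintro ⟨i, rfl⟩; exact ⟨_, (e i).2, rfl⟩
      · rintro ⟨B, hB, rfl⟩; exact ⟨e.symm ⟨B, hB⟩, by simp⟩
    have h2 := hs π hπ
    rw [h1]
    conv_rhs => rw [← h2]
    ext A
    constructor
    · rintro ⟨_, ⟨B, hB, rfl⟩, rfl⟩
      exact ⟨π • B, Set.smul_mem_smul_set hB, rfl⟩
    · rintro ⟨_, ⟨B, hB, rfl⟩, rfl⟩
      exact ⟨B.1, ⟨B, hB, rfl⟩, rfl⟩⟩

noncomputable def neg (A : Formula T κ) : Formula T κ := ⟨AlphaClass.neg A.1, .neg _ A.2⟩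

def pred (φ : Pred) : Formula T κ := ⟨AlphaClass.pred φ, .pred φ⟩

/-- `⟨α⟩A`, in which the binding names of `α` are abstracted. -/
noncomputable def may (α : Act) (A : Formula T κ) : Formula T κ :=
  ⟨AlphaClass.may α A.1, .may α _ A.2⟩

theorem smul_neg (π : NPerm 𝒩) (A : Formula T κ) : π • neg A = neg (π • A) :=
  Formula.ext (AlphaClass.smul_neg π A.1)

theorem smul_pred (π : NPerm 𝒩) (φ : Pred) : π • (pred φ : Formula T κ) = pred (π • φ) := rfl

theorem smul_may (π : NPerm 𝒩) (α : Act) (A : Formula T κ) :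
    π • may α A = may (π • α) (π • A) :=
  Formula.ext (AlphaClass.smul_may π α A.1)

/-- Members of the set of conjuncts are the classes of the direct subterms. -/
theorem mem_iff_conj {C : Set (Formula T κ)} (h : WF C) :
    ∃ (I : Set κ.out) (hI : #I < κ) (f : I → AlphaClass T κ),
      (conj C h).1 = AlphaClass.conj I hI f ∧ ∀ A : Formula T κ, A ∈ C ↔ ∃ i, f i = A.1 := by
  refine ⟨_, _, _, rfl, fun A => ⟨fun hA => ?_, ?_⟩⟩
  · exact ⟨(exists_index h.1).choose_spec.some.symm ⟨A, hA⟩, by simp⟩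
  · rintro ⟨i, hi⟩
    rw [← Formula.ext hi]
    exact Subtype.coe_prop _

/-- Every formula is finitely supported. -/
theorem finSupp (A : Formula T κ) : FinSupp 𝒩 A := by
  suffices h : ∀ A : AlphaClass T κ, IsFormula A → FinSupp 𝒩 A by
    obtain ⟨N, hN, hs⟩ := h A.1 A.2
    exact ⟨N, hN, fun π hπ => Formula.ext (hs π hπ)⟩
  intro A h
  induction h with
  | conj I hI A hA hs ih =>
    obtain ⟨N, hN, hs⟩ := hs
    refine ⟨N, hN, fun π hπ => ?_⟩
    have h1 := hs π hπ
    rw [AlphaClass.smul_conj, AlphaClass.conj, AlphaClass.conj, AlphaClass.mk_eq_mk, Raw.Alpha]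
    rw [← Set.image_smul, ← Set.range_comp] at h1
    refine ⟨fun i => ?_, fun j => ?_⟩
    · have h2 : π • A i ∈ Set.range A := by rw [← h1]; exact ⟨i, rfl⟩
      obtain ⟨j, hj⟩ := h2
      exact ⟨j, by rw [hj]; exact Raw.alpha_refl T _⟩
    · have h2 : A j ∈ Set.range ((fun x => π • x) ∘ A) := by rw [h1]; exact ⟨j, rfl⟩
      obtain ⟨i, hi⟩ := h2
      refine ⟨i, ?_⟩
      have hi' : π • A i = A j := hi
      rw [hi']; exact Raw.alpha_refl T _
  | neg A hA ih =>
    obtain ⟨N, hN, hs⟩ := ih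
    exact ⟨N, hN, fun π hπ => by rw [AlphaClass.smul_neg, hs π hπ]⟩
  | pred φ =>
    obtain ⟨N, hN, hs⟩ := Nominal.finSupp (𝒩 := 𝒩) φ
    exact ⟨N, hN, fun π hπ => by rw [AlphaClass.smul_pred, hs π hπ]⟩
  | may α A hA ih =>
    obtain ⟨N, hN, hs⟩ := ih
    obtain ⟨M, hM, hs'⟩ := Nominal.finSupp (𝒩 := 𝒩) α
    refine ⟨N ∪ M, hN.union hM, fun π hπ => ?_⟩
    rw [AlphaClass.smul_may, hs π fun a ha => hπ (Or.inl ha), hs' π fun a ha => hπ (Or.inr ha)]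

/-- The set of negations of the members of a well-formed set is well-formed. -/
theorem WF.neg {C : Set (Formula T κ)} (h : WF C) : WF (Formula.neg '' C) := by
  refine ⟨Cardinal.mk_image_le.trans_lt h.1, ?_⟩
  obtain ⟨N, hN, hs⟩ := h.2
  refine ⟨N, hN, fun π hπ => ?_⟩
  conv_rhs => rw [← hs π hπ]
  rw [← Set.image_smul, ← Set.image_smul, Set.image_image, Set.image_image]
  exact Set.image_congr fun A _ => smul_neg π A

/-- The disjunction `⋁ C`, defined as `¬ ⋀ {¬ A | A ∈ C}`. -/
noncomputable def disj (C : Set (Formula T κ)) (h : WF C) : Formula T κ :=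
  neg (conj (neg '' C) h.neg)

/-! ### Validity -/

/-- Immediate subformulas (`⟨α⟩A` has those of all its representatives). -/
inductive ImmSub : Formula T κ → Formula T κ → Prop
  | conj {A : Formula T κ} {C : Set (Formula T κ)} (h : WF C) (hA : A ∈ C) : ImmSub A (conj C h)
  | neg (A : Formula T κ) : ImmSub A (neg A)
  | may (α : Act) (A : Formula T κ) : ImmSub A (may α A)

theorem immSub_wf : WellFounded (ImmSub (T := T) (κ := κ)) := by
  suffices h : ∀ (R : Raw Pred Act κ) (π : NPerm 𝒩) (A : Formula T κ),
      A.1 = AlphaClass.mk (π • R) → Acc ImmSub A from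
    ⟨fun A => h A.1.rep 1 A (by rw [one_smul, AlphaClass.mk_rep])⟩
  intro R
  induction R with
  | conj I hI R ih =>
    intro π A hA
    refine ⟨A, fun B hB => ?_⟩
    cases hB with
    | conj h hB =>
      obtain ⟨J, hJ, f, e, hf⟩ := mem_iff_conj h
      obtain ⟨j, hj⟩ := (hf B).1 hB
      rw [e, AlphaClass.conj, AlphaClass.mk_eq_mk, Raw.smul_conj, Raw.Alpha] at hA
      obtain ⟨i, hi⟩ := hA.1 j
      refine ih i π B ?_
      rw [← AlphaClass.mk_eq_mk (T := T), AlphaClass.mk_rep] at hi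
      rw [← hj, hi]
    | neg => exact absurd (AlphaClass.mk_eq_mk.1 hA) (by rw [Raw.smul_conj]; simp [Raw.Alpha])
    | may => exact absurd (AlphaClass.mk_eq_mk.1 hA) (by rw [Raw.smul_conj]; simp [Raw.Alpha])
  | neg R ih =>
    intro π A hA
    refine ⟨A, fun B hB => ?_⟩
    cases hB with
    | conj h hB => exact absurd (AlphaClass.mk_eq_mk.1 hA) (by rw [Raw.smul_neg]; simp [Raw.Alpha])
    | neg =>
      have h := AlphaClass.mk_eq_mk.1 hA
      rw [Raw.smul_neg, Raw.Alpha, ← AlphaClass.mk_eq_mk (T := T), AlphaClass.mk_rep] at h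
      exact ih π B h
    | may => exact absurd (AlphaClass.mk_eq_mk.1 hA) (by rw [Raw.smul_neg]; simp [Raw.Alpha])
  | pred φ =>
    intro π A hA
    refine ⟨A, fun B hB => ?_⟩
    cases hB <;>
      exact absurd (AlphaClass.mk_eq_mk.1 hA) (by rw [Raw.smul_pred]; simp [Raw.Alpha])
  | may α R ih =>
    intro π A hA
    refine ⟨A, fun B hB => ?_⟩
    cases hB with
    | conj h hB => exact absurd (AlphaClass.mk_eq_mk.1 hA) (by rw [Raw.smul_may]; simp [Raw.Alpha])
    | neg => exact absurd (AlphaClass.mk_eq_mk.1 hA) (by rw [Raw.smul_may]; simp [Raw.Alpha])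
    | may =>
      have h := AlphaClass.mk_eq_mk.1 hA
      rw [Raw.smul_may, Raw.alpha_may_iff] at h
      obtain ⟨ρ, -, h, -⟩ := h
      rw [← AlphaClass.mk_eq_mk (T := T), AlphaClass.mk_rep, ← mul_smul] at h
      exact ih _ B h

instance : WellFoundedRelation (Formula T κ) := ⟨ImmSub, immSub_wf⟩

end Formula

namespace NTS

/-- `P -α→ P'`. -/
def Trans (T : NTS 𝒩 State Pred Act) (P : State) (α : Act) (P' : State) : Prop :=
  (P, NameAbs.mk (T.bn α) (α, P')) ∈ T.tr

end NTS

/-- Validity `P ⊨ A`. In the last clause `⟨α⟩B` is a representative of `A` such that the binding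
names of `α` are fresh for `P`. -/
def Valid (P : State) (A : Formula T κ) : Prop :=
  (∃ (C : Set (Formula T κ)) (h : Formula.WF C) (_ : A = Formula.conj C h),
    ∀ B, (hB : B ∈ C) → Valid P B) ∨
  (∃ (B : Formula T κ) (_ : A = Formula.neg B), ¬ Valid P B) ∨
  (∃ φ : Pred, A = Formula.pred φ ∧ T.entails P φ) ∨
  (∃ (α : Act) (B : Formula T κ) (_ : A = Formula.may α B),
    Fresh (T.bn α) P ∧ ∃ P', T.Trans P α P' ∧ Valid P' B)
termination_by A
decreasing_by
  · subst_vars; exact Formula.ImmSub.conj _ hB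
  · subst_vars; exact Formula.ImmSub.neg _
  · subst_vars; exact Formula.ImmSub.may _ _

end Formulas

/-! ### Weak bisimilarity and weak formulas -/

section Weak

variable {𝒩 : Type u} [Names 𝒩] {State Pred Act : Type u}
  [Nominal 𝒩 State] [Nominal 𝒩 Pred] [Nominal 𝒩 Act]

namespace WeakNTS

variable (T : WeakNTS 𝒩 State Pred Act)

/-- `P ⇒ P'` -/
def TauStar : State → State → Prop := Relation.ReflTransGen fun P P' => T.Trans P T.τ P'

/-- `P ⇒ -α→ ⇒ P'` -/
def WTrans (P : State) (α : Act) (P' : State) : Prop :=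
  ∃ P₁ P₂, T.TauStar P P₁ ∧ T.Trans P₁ α P₂ ∧ T.TauStar P₂ P'

/-- `P ⇒ P'` if `α = τ`, and `P ⇒ -α→ ⇒ P'` otherwise. -/
def HTrans (P : State) (α : Act) (P' : State) : Prop :=
  (α = T.τ ∧ T.TauStar P P') ∨ (α ≠ T.τ ∧ T.WTrans P α P')

def IsWeakSimulation (R : State → State → Prop) : Prop :=
  ∀ P Q, R P Q → ∀ α P', Fresh (T.bn α) Q → T.Trans P α P' → ∃ Q', T.HTrans Q α Q' ∧ R P' Q'

def IsWeakStaticImplication (R : State → State → Prop) : Prop :=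
  ∀ P Q, R P Q → ∀ φ, T.entails P φ → ∃ Q', T.TauStar Q Q' ∧ T.entails Q' φ ∧ R P Q'

def IsWeakBisimulation (R : State → State → Prop) : Prop :=
  (∀ P Q, R P Q → R Q P) ∧ T.IsWeakSimulation R ∧ T.IsWeakStaticImplication R

/-- Weak bisimilarity. -/
def WeakBisim (P Q : State) : Prop := ∃ R, T.IsWeakBisimulation R ∧ R P Q

end WeakNTS

namespace Formula

variable {T : WeakNTS 𝒩 State Pred Act} {κ : Cardinal.{u}}

/-- `⟨τ⟩^i A` -/
noncomputable def tauPow (A : Formula T.toNTS κ) : ℕ → Formula T.toNTS κ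
  | 0 => A
  | i + 1 => may T.τ (tauPow A i)


theorem smul_tauPow (π : NPerm 𝒩) (A : Formula T.toNTS κ) (i : ℕ) :
    π • tauPow A i = tauPow (π • A) i := by
  induction i with
  | zero => rfl
  | succ i ih => rw [tauPow, smul_may, ih, T.τ_smul, tauPow]

variable [hκ : Fact (ℵ₀ < κ)]

theorem wf_tauPow (A : Formula T.toNTS κ) : WF (Set.range (tauPow A)) := by
  refine ⟨lt_of_le_of_lt ?_ hκ.out, ?_⟩
  · exact Cardinal.mk_le_aleph0_iff.2 (Set.countable_range _).to_subtype
  · obtain ⟨N, hN, hs⟩ := finSupp A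
    refine ⟨N, hN, fun π hπ => ?_⟩
    rw [← Set.image_smul, ← Set.range_comp]
    congr 1
    funext i
    simp [smul_tauPow, hs π hπ]

/-- `⟨⟨τ⟩⟩A`, the disjunction of all `⟨τ⟩^i A`. -/
noncomputable def wmayTau (A : Formula T.toNTS κ) : Formula T.toNTS κ :=
  disj (Set.range (tauPow A)) (wf_tauPow A)

open Classical in
/-- `⟨⟨α⟩⟩A`, which is `⟨⟨τ⟩⟩⟨α⟩⟨⟨τ⟩⟩A` for `α ≠ τ`. -/
noncomputable def wmay (α : Act) (A : Formula T.toNTS κ) : Formula T.toNTS κ :=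
  if α = T.τ then wmayTau A else wmayTau (may α (wmayTau A))

theorem wf_pair {T : NTS 𝒩 State Pred Act} (A B : Formula T κ) :
    WF ({A, B} : Set (Formula T κ)) := by
  refine ⟨lt_of_le_of_lt ?_ hκ.out, ?_⟩
  · exact Cardinal.mk_le_aleph0_iff.2 (Set.toFinite _).countable.to_subtype
  · obtain ⟨N, hN, hs⟩ := finSupp A
    obtain ⟨M, hM, hs'⟩ := finSupp B
    refine ⟨N ∪ M, hN.union hM, fun π hπ => ?_⟩
    rw [← Set.image_smul, Set.image_pair, hs π fun a ha => hπ (Or.inl ha),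
      hs' π fun a ha => hπ (Or.inr ha)]

/-- Binary conjunction. -/
noncomputable def and {T : NTS 𝒩 State Pred Act} (A B : Formula T κ) : Formula T κ :=
  conj {A, B} (wf_pair A B)

/-- Weak formulas. -/
inductive IsWeak : Formula T.toNTS κ → Prop
  | conj (C : Set (Formula T.toNTS κ)) (h : WF C) (hC : ∀ A ∈ C, IsWeak A) : IsWeak (conj C h)
  | neg (A : Formula T.toNTS κ) (hA : IsWeak A) : IsWeak (neg A)
  | wmay (α : Act) (A : Formula T.toNTS κ) (hA : IsWeak A) : IsWeak (wmay α A)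
  | wmayPred (A : Formula T.toNTS κ) (φ : Pred) (hA : IsWeak A) :
      IsWeak (wmay T.τ (and A (pred φ)))

end Formula

variable (T : WeakNTS 𝒩 State Pred Act) (κ : Cardinal.{u}) [Fact (ℵ₀ < κ)]

/-- Weak logical equivalence. -/
def WeakEquiv (P Q : State) : Prop :=
  ∀ A : Formula T.toNTS κ, A.IsWeak → (Valid P A ↔ Valid Q A)

variable {κ}

/-- `A` is a distinguishing weak formula for `P` and `Q`. -/
def IsDistinguishingWeak (P Q : State) (A : Formula T.toNTS κ) : Prop :=
  A.IsWeak ∧ Valid P A ∧ ¬ Valid Q A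

/-- `A` is a characteristic weak formula for `P`. -/
def IsCharacteristicWeak (P : State) (A : Formula T.toNTS κ) : Prop :=
  A.IsWeak ∧ ∀ Q, T.WeakBisim P Q ↔ Valid Q A

/-- `B P Q` is, for all `P` and `Q` that are not weakly logically equivalent, a distinguishing weak
formula for `P` and `Q` with support included in the support of `P`. -/
def IsDistinguishingChoice (B : State → State → Formula T.toNTS κ) : Prop :=
  ∀ P Q, ¬ WeakEquiv T κ P Q →
    IsDistinguishingWeak T P Q (B P Q) ∧ supp 𝒩 (B P Q) ⊆ supp 𝒩 P

variable {T}

/-- The conjuncts `π⁻¹ · B (π · P) (π · Q)` of `D(P, Q)`. -/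
def distSet (B : State → State → Formula T.toNTS κ) (P Q : State) : Set (Formula T.toNTS κ) :=
  Set.range fun π : NPerm 𝒩 => π⁻¹ • B (π • P) (π • Q)

/-- The conjuncts `D(P, Q)` of `Char(P)`, one for each `Q` that is not weakly logically equivalent
to `P`, where `D(P, Q)` is the conjunction of `distSet B P Q`. -/
def charSet (B : State → State → Formula T.toNTS κ)
    (hD : ∀ P Q, ¬ WeakEquiv T κ P Q → Formula.WF (distSet B P Q)) (P : State) :
    Set (Formula T.toNTS κ) :=
  {A | ∃ (Q : State) (h : ¬ WeakEquiv T κ P Q), A = Formula.conj (distSet B P Q) (hD P Q h)}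

/-- `Char(P)`. -/
noncomputable def charFormula (B : State → State → Formula T.toNTS κ)
    (hD : ∀ P Q, ¬ WeakEquiv T κ P Q → Formula.WF (distSet B P Q))
    (hC : ∀ P, Formula.WF (charSet B hD P)) (P : State) : Formula T.toNTS κ :=
  Formula.conj (charSet B hD P) (hC P)

end Weak

end NomTS

open NomTS

/-! The heart of the matter is that weak bisimilarity and weak logical equivalence coincide
(`weakBisim_iff_weakEquiv`).

From bisimilarity to equivalence, one argues by induction on weak formulas. The delicate case is
`⟨⟨α⟩⟩A`: the binding names of `α` are first renamed apart from the states reached, and the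
induction hypothesis is transported along the renaming because validity and weak bisimilarity are
equivariant.

Conversely, logical equivalence is itself a weak bisimulation. If no weak successor of `Q` were
equivalent to `P'`, one would conjoin formulas separating `P'` from each successor. This conjunction
must have finite support and fewer than `κ` members. The size is bounded by the number of states.
For the support, every distinguishing formula for `P` and `Q` can be replaced by the conjunction of
its images under the permutations that fix `supp P` pointwise, whose support lies in `supp P`
(`exists_isDistinguishingWeak_supp_subset`). Conjuncts with supports inside one common finite set
always form a finitely supported set. There are only countably many permutations and `κ` is
uncountable, so such orbits are small enough.

The same bound makes `D(P,Q)` and `Char(P)` well-formed. The choice `B` need not be equivariant;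
averaging over all permutations in `D` repairs this, so that `Char` is equivariant
(`smul_charFormula`). Hence any support of `S` supports `{Char(P') | P' ∈ S}`, and the disjunction
over a finitely supported `S` is a formula. -/

namespace NomTS

/-! ### Building permutations from transpositions; countability of the permutation group. -/

section Permutations

variable {𝒩 : Type u} [Names 𝒩]

theorem srt_smul (π : NPerm 𝒩) (a : 𝒩) : Names.srt (π • a) = Names.srt a := π.2.2 a

/-- The transposition of two names of the same sort. -/
def nswap [DecidableEq 𝒩] (a b : 𝒩) (h : Names.srt a = Names.srt b) : NPerm 𝒩 :=
  ⟨Equiv.swap a b, by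
    refine ⟨(Set.toFinite {a, b}).subset fun c hc => ?_, fun c => ?_⟩
    · by_contra h'
      simp only [Set.mem_insert_iff, Set.mem_singleton_iff, not_or] at h'
      exact hc (Equiv.swap_apply_of_ne_of_ne h'.1 h'.2)
    · rw [Equiv.swap_apply_def]
      split_ifs with h1 h2
      · rw [h1, h]
      · rw [h2, h]
      · rfl⟩

theorem nswap_left [DecidableEq 𝒩] {a b : 𝒩} (h : Names.srt a = Names.srt b) :
    nswap a b h • a = b := Equiv.swap_apply_left a b

theorem nswap_of_ne [DecidableEq 𝒩] {a b c : 𝒩} (h : Names.srt a = Names.srt b)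
    (ha : c ≠ a) (hb : c ≠ b) : nswap a b h • c = c := Equiv.swap_apply_of_ne_of_ne ha hb

/-- A permutation can be modified to be the identity outside a finite set and its image. -/
theorem exists_perm_eqOn (ρ : NPerm 𝒩) (N : Finset 𝒩) :
    ∃ π : NPerm 𝒩, (∀ a ∈ N, π • a = ρ • a) ∧
      ∀ c, c ∉ N → (∀ a ∈ N, ρ • a ≠ c) → π • c = c := by
  classical
  induction N using Finset.induction_on with
  | empty => exact ⟨1, by simp, fun c _ _ => one_smul _ c⟩
  | insert a N ha ih =>
    obtain ⟨π, h1, h2⟩ := ih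
    have hs : Names.srt (π • a) = Names.srt (ρ • a) := by rw [srt_smul, srt_smul]
    -- The transposition corrects the value at `a`. It leaves the values on `N` alone, since these
    -- are already those of `ρ` and both `π` and `ρ` are injective.
    refine ⟨nswap (π • a) (ρ • a) hs * π, fun b hb => ?_, fun c hc hc' => ?_⟩
    · rw [mul_smul]
      by_cases hba : b = a
      · rw [hba, nswap_left]
      · have hb' : b ∈ N := (Finset.mem_insert.1 hb).resolve_left hba
        have e := h1 b hb'
        rw [nswap_of_ne hs (fun h => hba (smul_left_cancel π h))
          (fun h => hba (smul_left_cancel ρ (e.symm.trans h))), e]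
    · rw [Finset.mem_insert, not_or] at hc
      have e := h2 c hc.2 fun b hb => hc' b (Finset.mem_insert_of_mem hb)
      rw [mul_smul, e]
      refine nswap_of_ne hs (fun h => hc.1 ?_)
        (hc' a (Finset.mem_insert_self _ _)).symm
      exact smul_left_cancel π (e.trans h)

/-- Finitely many names can be moved away from a finite set of names, with all other names of that
set fixed. -/
theorem exists_perm_fresh (N : Finset 𝒩) {M : Set 𝒩} (hM : M.Finite) :
    ∃ π : NPerm 𝒩, (∀ a ∈ N, π • a ∉ M) ∧ ∀ c ∈ M, c ∉ N → π • c = c := by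
  classical
  induction N using Finset.induction_on with
  | empty => exact ⟨1, by simp, fun c _ _ => one_smul _ c⟩
  | insert a N ha ih =>
    obtain ⟨π, h1, h2⟩ := ih
    -- The new name `c` must avoid `M` and also the images of `N`, so that the transposition does
    -- not undo the earlier moves.
    obtain ⟨c, hc, hc'⟩ := (Names.infinite_sort a).exists_notMem_finite
      (hM.union (N.finite_toSet.image fun b => π • b))
    have hs : Names.srt (π • a) = Names.srt c := by rw [srt_smul]; exact Eq.symm hc
    rw [Set.mem_union, not_or] at hc'
    refine ⟨nswap (π • a) c hs * π, fun b hb => ?_, fun d hd hd' => ?_⟩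
    · rw [mul_smul]
      by_cases hba : b = a
      · rw [hba, nswap_left]; exact hc'.1
      · have hb' : b ∈ N := (Finset.mem_insert.1 hb).resolve_left hba
        rw [nswap_of_ne hs (fun h => hba (smul_left_cancel π h))
          (fun h => hc'.2 ⟨b, hb', h⟩)]
        exact h1 b hb'
    · rw [Finset.mem_insert, not_or] at hd'
      have e := h2 d hd hd'.2
      rw [mul_smul, e]
      refine nswap_of_ne hs (fun h => hd'.1 ?_) (fun h => hc'.1 (h ▸ hd))
      exact smul_left_cancel π (e.trans h)

/-- A permutation is determined by its finite graph on the names that it moves. Countability keeps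
conjunctions over permutations below `κ`. -/
instance : Countable (NPerm 𝒩) := by
  classical
  have : Countable 𝒩 := Names.countable
  let f : NPerm 𝒩 → Finset (𝒩 × 𝒩) := fun π => π.2.1.toFinset.image fun a => (a, π • a)
  refine Function.Injective.countable (f := f) fun π ρ h => ?_
  have key : ∀ π ρ : NPerm 𝒩, f π = f ρ → ∀ a : 𝒩, π • a ≠ a → π • a = ρ • a := by
    intro π ρ h a ha
    have : (a, π • a) ∈ f π :=
      Finset.mem_image.2 ⟨a, (Set.Finite.mem_toFinset _).2 ha, rfl⟩
    rw [h] at this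
    obtain ⟨b, -, hb⟩ := Finset.mem_image.1 this
    obtain ⟨rfl, hb⟩ := Prod.mk.inj hb
    exact hb.symm
  refine Subtype.ext (Equiv.ext fun a => ?_)
  change π • a = ρ • a
  by_cases h1 : π • a = a
  · by_cases h2 : ρ • a = a
    · rw [h1, h2]
    · exact (key ρ π h.symm a h2).symm
  · exact key π ρ h a h1

end Permutations

/-! ### Least supports, and supports of sets. -/

section Supports

variable {𝒩 : Type u} [Names 𝒩] {X : Type u} [MulAction (NPerm 𝒩) X]

/-- Let `π` fix `N ∩ M`. Some `σ` fixes `M`, hence `x`, and carries `N \ M` to names that `π` does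
not move. Then `σ • N` supports `x` and `π` fixes it pointwise. -/
theorem supports_inter {x : X} {N M : Set 𝒩} (hN : N.Finite) (hM : M.Finite)
    (hNx : MulAction.Supports (NPerm 𝒩) N x) (hMx : MulAction.Supports (NPerm 𝒩) M x) :
    MulAction.Supports (NPerm 𝒩) (N ∩ M) x := by
  classical
  intro π hπ
  obtain ⟨σ, h1, h2⟩ := exists_perm_fresh (hN.sdiff (t := M)).toFinset (hM.union π.2.1)
  have hσx : σ • x = x := hMx σ fun a ha => h2 a (Or.inl ha) fun h =>
    ((Set.Finite.mem_toFinset _).1 h).2 ha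
  have h3 := supports_smul σ hNx
  rw [hσx] at h3
  refine h3 π ?_
  rintro _ ⟨a, ha, rfl⟩
  change π • (σ • a) = σ • a
  by_cases haM : a ∈ M
  · rw [h2 a (Or.inl haM) fun h => ((Set.Finite.mem_toFinset _).1 h).2 haM]
    exact hπ ⟨ha, haM⟩
  · by_contra h
    exact h1 a ((Set.Finite.mem_toFinset _).2 ⟨ha, haM⟩) (Or.inr h)

/-- A finite support of minimal cardinality lies inside every other one, by `supports_inter`; so the
intersection that defines `supp` is itself a support. -/
theorem exists_supp_eq {x : X} (h : FinSupp 𝒩 x) :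
    (supp 𝒩 x).Finite ∧ MulAction.Supports (NPerm 𝒩) (supp 𝒩 x) x := by
  obtain ⟨N, ⟨hN, hNx⟩, hmin⟩ :=
    WellFounded.has_min (InvImage.wf Set.ncard wellFounded_lt)
      {N : Set 𝒩 | N.Finite ∧ MulAction.Supports (NPerm 𝒩) N x} h
  have e : supp 𝒩 x = N := by
    refine Set.Subset.antisymm (fun a ha => ha N hN hNx) fun a ha M hM hMx => ?_
    by_contra haM
    refine hmin (N ∩ M) ⟨hN.inter_of_left M, supports_inter hN hM hNx hMx⟩ ?_
    exact Set.ncard_lt_ncard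
      ⟨Set.inter_subset_left, fun h' => haM (h' ha).2⟩ hN
  rw [e]
  exact ⟨hN, hNx⟩

theorem supp_finite {x : X} (h : FinSupp 𝒩 x) : (supp 𝒩 x).Finite := (exists_supp_eq h).1

theorem smul_eq_of_fixes_supp {x : X} (h : FinSupp 𝒩 x) {π : NPerm 𝒩}
    (hπ : ∀ a ∈ supp 𝒩 x, π • a = a) : π • x = x := (exists_supp_eq h).2 π fun {a} => hπ a

theorem supp_subset {x : X} {N : Set 𝒩} (hN : N.Finite)
    (h : MulAction.Supports (NPerm 𝒩) N x) : supp 𝒩 x ⊆ N := fun _ ha => ha N hN h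

theorem smul_eq_smul_of_eqOn_supp {x : X} (h : FinSupp 𝒩 x) {π ρ : NPerm 𝒩}
    (hπ : ∀ a ∈ supp 𝒩 x, π • a = ρ • a) : π • x = ρ • x := by
  rw [← inv_smul_eq_iff, ← mul_smul]
  refine smul_eq_of_fixes_supp h fun a ha => ?_
  rw [mul_smul, hπ a ha, inv_smul_smul]

/-- One inclusion is enough, because the inverse of a permutation fixing `N` also fixes `N`. -/
theorem smul_set_subset_supports {C : Set X} {N : Set 𝒩}
    (h : ∀ π : NPerm 𝒩, (∀ a ∈ N, π • a = a) → ∀ x ∈ C, π • x ∈ C) :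
    MulAction.Supports (NPerm 𝒩) N C := by
  intro π hπ
  refine Set.Subset.antisymm ?_ fun x hx => ?_
  · rintro _ ⟨x, hx, rfl⟩
    exact h π (fun a ha => hπ ha) x hx
  · refine Set.mem_smul_set_iff_inv_smul_mem.2 (h π⁻¹ (fun a ha => ?_) x hx)
    rw [inv_smul_eq_iff]; exact (hπ ha).symm

/-- A permutation fixing the common bound `N` fixes each member. This is how most conjunctions below
are seen to be finitely supported. -/
theorem supports_set_of_supp_subset {C : Set X} {N : Set 𝒩} (hfin : ∀ x ∈ C, FinSupp 𝒩 x)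
    (h : ∀ x ∈ C, supp 𝒩 x ⊆ N) : MulAction.Supports (NPerm 𝒩) N C :=
  smul_set_subset_supports fun π hπ x hx => by
    rwa [smul_eq_of_fixes_supp (hfin x hx) fun a ha => hπ a (h x hx ha)]

theorem Fresh.smul {N : Finset 𝒩} {x : X} (h : Fresh N x) (π : NPerm 𝒩) :
    Fresh (permFinset π N) (π • x) := fun a ha ha' =>
  h _ ((mem_permFinset π N a).1 ha) (mem_supp_smul ha')

theorem smul_mem_permFinset {π : NPerm 𝒩} {N : Finset 𝒩} {a : 𝒩} :
    π • a ∈ permFinset π N ↔ a ∈ N := by rw [mem_permFinset, inv_smul_smul]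

theorem fresh_permFinset {N : Finset 𝒩} {x : X} {π : NPerm 𝒩}
    (h : ∀ a ∈ N, π • a ∉ supp 𝒩 x) : Fresh (permFinset π N) x := fun a ha => by
  simpa using h _ ((mem_permFinset π N a).1 ha)

end Supports

section Product

variable {𝒩 : Type u} [Names 𝒩] {X Y : Type u} [MulAction (NPerm 𝒩) X] [MulAction (NPerm 𝒩) Y]

theorem supp_prod_subset {x : X} {y : Y} (hx : FinSupp 𝒩 x) (hy : FinSupp 𝒩 y) :
    supp 𝒩 (x, y) ⊆ supp 𝒩 x ∪ supp 𝒩 y := by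
  refine supp_subset ((supp_finite hx).union (supp_finite hy)) fun π hπ => ?_
  exact Prod.ext (smul_eq_of_fixes_supp hx fun a ha => hπ (Or.inl ha))
    (smul_eq_of_fixes_supp hy fun a ha => hπ (Or.inr ha))

end Product

/-! ### Equality of formulas: constructors are disjoint, and injective up to alpha-equivalence. -/

section Formulas

variable {𝒩 : Type u} [Names 𝒩] {State Pred Act : Type u}
  [Nominal 𝒩 State] [Nominal 𝒩 Pred] [Nominal 𝒩 Act]
  {T : NTS 𝒩 State Pred Act} {κ : Cardinal.{u}}

theorem AlphaClass.conj_eq_conj {I J : Set κ.out} {hI : #I < κ} {hJ : #J < κ}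
    {A : I → AlphaClass T κ} {B : J → AlphaClass T κ} :
    AlphaClass.conj I hI A = AlphaClass.conj J hJ B ↔ Set.range A = Set.range B := by
  have e : ∀ i j, Raw.Alpha T (A i).rep (B j).rep ↔ A i = B j := fun i j => by
    rw [← mk_eq_mk (T := T), mk_rep, mk_rep]
  rw [AlphaClass.conj, AlphaClass.conj, mk_eq_mk, Raw.Alpha]
  simp only [e]
  constructor
  · rintro ⟨h1, h2⟩
    refine Set.Subset.antisymm ?_ ?_
    · rintro _ ⟨i, rfl⟩
      obtain ⟨j, hj⟩ := h1 i
      exact ⟨j, hj.symm⟩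
    · rintro _ ⟨j, rfl⟩
      exact h2 j
  · intro h
    refine ⟨fun i => ?_, fun j => ?_⟩
    · obtain ⟨j, hj⟩ := h.subset ⟨i, rfl⟩
      exact ⟨j, hj.symm⟩
    · exact h.superset ⟨j, rfl⟩

/-- Alpha-equivalence of representatives is equality of classes. This turns the raw clause for `may`
into the usual nominal one in `may_eq_may`. -/
theorem Raw.asupp_rep (A : AlphaClass T κ) : Raw.asupp T A.rep = supp 𝒩 A := by
  have e : ∀ ρ : NPerm 𝒩, Raw.Alpha T A.rep (ρ • A.rep) ↔ ρ • A = A := fun ρ => by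
    rw [← AlphaClass.mk_eq_mk (T := T), ← AlphaClass.smul_mk, AlphaClass.mk_rep, eq_comm]
  simp only [Raw.asupp, e]
  rfl

namespace Formula

theorem supp_val (A : Formula T κ) : supp 𝒩 A.1 = supp 𝒩 A := by
  have e : ∀ N : Set 𝒩,
      MulAction.Supports (NPerm 𝒩) N A.1 ↔ MulAction.Supports (NPerm 𝒩) N A := fun N =>
    forall_congr' fun π => imp_congr_right fun _ =>
      (Formula.ext_iff (x := π • A) (y := A)).symm
  simp only [supp, e]

theorem exists_conj_val {C : Set (Formula T κ)} (h : WF C) :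
    ∃ (I : Set κ.out) (hI : #I < κ) (f : I → AlphaClass T κ),
      (conj C h).1 = AlphaClass.conj I hI f ∧ Set.range f = Formula.val '' C := by
  refine ⟨_, _, _, rfl, ?_⟩
  ext A
  constructor
  · rintro ⟨i, rfl⟩; exact ⟨_, Subtype.coe_prop _, rfl⟩
  · rintro ⟨B, hB, rfl⟩
    exact ⟨(exists_index h.1).choose_spec.some.symm ⟨B, hB⟩, by simp⟩

theorem val_injective : Function.Injective (Formula.val : Formula T κ → AlphaClass T κ) :=
  fun _ _ => Formula.ext

theorem conj_inj {C D : Set (Formula T κ)} {hC : WF C} {hD : WF D} :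
    conj C hC = conj D hD ↔ C = D := by
  refine ⟨fun h => ?_, fun h => by subst h; rfl⟩
  obtain ⟨I, hI, f, e, hf⟩ := exists_conj_val hC
  obtain ⟨J, hJ, g, e', hg⟩ := exists_conj_val hD
  rw [Formula.ext_iff, e, e', AlphaClass.conj_eq_conj, hf, hg] at h
  exact val_injective.image_injective h

theorem WF.smul (π : NPerm 𝒩) {C : Set (Formula T κ)} (h : WF C) : WF (π • C) :=
  ⟨by rw [← Set.image_smul]; exact Cardinal.mk_image_le.trans_lt h.1, finSupp_smul π h.2⟩

theorem smul_conj (π : NPerm 𝒩) (C : Set (Formula T κ)) (h : WF C) :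
    π • conj C h = conj (π • C) (h.smul π) := by
  obtain ⟨I, hI, f, e, hf⟩ := exists_conj_val h
  obtain ⟨J, hJ, g, e', hg⟩ := exists_conj_val (h.smul π)
  rw [Formula.ext_iff, smul_val, e, e', AlphaClass.smul_conj, AlphaClass.conj_eq_conj, hg,
    Set.range_comp' (fun x => π • x) f, hf, Set.image_image, ← Set.image_smul, Set.image_image]
  rfl

theorem conj_ne_neg {C : Set (Formula T κ)} {h : WF C} {A : Formula T κ} : conj C h ≠ neg A := by
  obtain ⟨I, hI, f, e, hf⟩ := exists_conj_val h
  intro h'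
  rw [Formula.ext_iff, e] at h'
  exact absurd (AlphaClass.mk_eq_mk.1 h') (by simp [Raw.Alpha])

theorem conj_ne_pred {C : Set (Formula T κ)} {h : WF C} {φ : Pred} : conj C h ≠ pred φ := by
  obtain ⟨I, hI, f, e, hf⟩ := exists_conj_val h
  intro h'
  rw [Formula.ext_iff, e] at h'
  exact absurd (AlphaClass.mk_eq_mk.1 h') (by simp [Raw.Alpha])

theorem conj_ne_may {C : Set (Formula T κ)} {h : WF C} {α : Act} {A : Formula T κ} :
    conj C h ≠ may α A := by
  obtain ⟨I, hI, f, e, hf⟩ := exists_conj_val h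
  intro h'
  rw [Formula.ext_iff, e] at h'
  exact absurd (AlphaClass.mk_eq_mk.1 h') (by simp [Raw.Alpha])

theorem neg_ne_pred {A : Formula T κ} {φ : Pred} : neg A ≠ pred φ := fun h =>
  absurd (AlphaClass.mk_eq_mk.1 (Formula.ext_iff.1 h)) (by simp [Raw.Alpha])

theorem neg_ne_may {A B : Formula T κ} {α : Act} : neg A ≠ may α B := fun h =>
  absurd (AlphaClass.mk_eq_mk.1 (Formula.ext_iff.1 h)) (by simp [Raw.Alpha])

theorem pred_ne_may {B : Formula T κ} {α : Act} {φ : Pred} : pred φ ≠ may α B := fun h =>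
  absurd (AlphaClass.mk_eq_mk.1 (Formula.ext_iff.1 h)) (by simp [Raw.Alpha])

theorem neg_inj {A B : Formula T κ} : neg A = neg B ↔ A = B := by
  refine ⟨fun h => ?_, fun h => by rw [h]⟩
  have h' := AlphaClass.mk_eq_mk.1 (Formula.ext_iff.1 h)
  rw [Raw.Alpha, ← AlphaClass.mk_eq_mk (T := T), AlphaClass.mk_rep, AlphaClass.mk_rep] at h'
  exact Formula.ext h'

theorem pred_inj {φ ψ : Pred} : (pred φ : Formula T κ) = pred ψ ↔ φ = ψ := by
  refine ⟨fun h => ?_, fun h => by rw [h]⟩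
  have h' := AlphaClass.mk_eq_mk.1 (Formula.ext_iff.1 h)
  rwa [Raw.Alpha] at h'

/-- Alpha-equivalence of formulas `⟨α⟩A`. -/
theorem may_eq_may {α β : Act} {A B : Formula T κ} :
    may α A = may β B ↔ ∃ π : NPerm 𝒩, π • α = β ∧ π • A = B ∧
      ∀ a, a ∈ supp 𝒩 α ∨ a ∈ supp 𝒩 A → a ∉ T.bn α → π • a = a := by
  rw [Formula.ext_iff]
  change AlphaClass.mk _ = AlphaClass.mk _ ↔ _
  rw [AlphaClass.mk_eq_mk, Raw.alpha_may_iff]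
  refine exists_congr fun π => and_congr_right fun _ => ?_
  rw [Raw.asupp_rep, supp_val, ← AlphaClass.mk_eq_mk (T := T), ← AlphaClass.smul_mk,
    AlphaClass.mk_rep, AlphaClass.mk_rep, eq_inv_smul_iff, Formula.ext_iff, smul_val]

theorem may_smul_eq {α : Act} {A : Formula T κ} {π : NPerm 𝒩}
    (h : ∀ a, a ∈ supp 𝒩 α ∨ a ∈ supp 𝒩 A → a ∉ T.bn α → π • a = a) :
    may (π • α) (π • A) = may α A :=
  (may_eq_may.2 ⟨π, rfl, rfl, h⟩).symm

theorem exists_eq_constructor (A : Formula T κ) :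
    (∃ C h, A = conj C h) ∨ (∃ B, A = neg B) ∨ (∃ φ, A = pred φ) ∨ ∃ α B, A = may α B := by
  obtain ⟨A, hA⟩ := A
  cases hA with
  | conj I hI f hf hs =>
    left
    let g : I → Formula T κ := fun i => ⟨f i, hf i⟩
    have hC : WF (Set.range g) := by
      refine ⟨Cardinal.mk_range_le.trans_lt hI, ?_⟩
      obtain ⟨N, hN, hs⟩ := hs
      refine ⟨N, hN, smul_set_subset_supports ?_⟩
      rintro π hπ _ ⟨i, rfl⟩
      have h1 : π • f i ∈ Set.range f := by
        rw [← hs π fun {a} => hπ a]; exact Set.smul_mem_smul_set ⟨i, rfl⟩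
      obtain ⟨j, hj⟩ := h1
      exact ⟨j, Formula.ext hj⟩
    refine ⟨_, hC, Formula.ext ?_⟩
    obtain ⟨J, hJ, k, e, hk⟩ := exists_conj_val hC
    rw [e, AlphaClass.conj_eq_conj, hk, ← Set.range_comp]
    rfl
  | neg A hA => exact Or.inr (Or.inl ⟨⟨A, hA⟩, rfl⟩)
  | pred φ => exact Or.inr (Or.inr (Or.inl ⟨φ, rfl⟩))
  | may α A hA => exact Or.inr (Or.inr (Or.inr ⟨α, ⟨A, hA⟩, rfl⟩))

theorem supp_conj_subset {C : Set (Formula T κ)} {h : WF C} {N : Set 𝒩} (hN : N.Finite)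
    (hs : MulAction.Supports (NPerm 𝒩) N C) : supp 𝒩 (conj C h) ⊆ N := by
  refine supp_subset hN fun π hπ => ?_
  rw [smul_conj, conj_inj]
  exact hs π hπ

end Formula

/-! ### Validity -/

open Formula

theorem valid_conj {P : State} {C : Set (Formula T κ)} {h : WF C} :
    Valid P (conj C h) ↔ ∀ A ∈ C, Valid P A := by
  rw [Valid]
  constructor
  · rintro (⟨D, hD, e, hv⟩ | ⟨B, e, -⟩ | ⟨φ, e, -⟩ | ⟨α, B, e, -⟩)
    · rw [conj_inj] at e; subst e; exact hv
    · exact absurd e conj_ne_neg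
    · exact absurd e conj_ne_pred
    · exact absurd e conj_ne_may
  · exact fun hv => Or.inl ⟨C, h, rfl, hv⟩

theorem valid_neg {P : State} {A : Formula T κ} : Valid P (neg A) ↔ ¬ Valid P A := by
  rw [Valid]
  constructor
  · rintro (⟨D, hD, e, -⟩ | ⟨B, e, hv⟩ | ⟨φ, e, -⟩ | ⟨α, B, e, -⟩)
    · exact absurd e.symm conj_ne_neg
    · rw [Formula.neg_inj] at e; subst e; exact hv
    · exact absurd e neg_ne_pred
    · exact absurd e neg_ne_may
  · exact fun hv => Or.inr (Or.inl ⟨A, rfl, hv⟩)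

theorem valid_pred {P : State} {φ : Pred} : Valid P (pred φ : Formula T κ) ↔ T.entails P φ := by
  rw [Valid]
  constructor
  · rintro (⟨D, hD, e, -⟩ | ⟨B, e, -⟩ | ⟨ψ, e, hv⟩ | ⟨α, B, e, -⟩)
    · exact absurd e.symm conj_ne_pred
    · exact absurd e.symm neg_ne_pred
    · rw [pred_inj] at e; subst e; exact hv
    · exact absurd e pred_ne_may
  · exact fun hv => Or.inr (Or.inr (Or.inl ⟨φ, rfl, hv⟩))

/-- The representative stays existential here; `valid_may_of_trans` and `exists_trans_of_valid_may`
eliminate it. -/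
theorem valid_may {P : State} {α : Act} {A : Formula T κ} :
    Valid P (may α A) ↔ ∃ (β : Act) (B : Formula T κ), may α A = may β B ∧
      Fresh (T.bn β) P ∧ ∃ P', T.Trans P β P' ∧ Valid P' B := by
  rw [Valid]
  constructor
  · rintro (⟨D, hD, e, -⟩ | ⟨B, e, -⟩ | ⟨ψ, e, -⟩ | ⟨β, B, e, hv⟩)
    · exact absurd e.symm conj_ne_may
    · exact absurd e.symm neg_ne_may
    · exact absurd e.symm pred_ne_may
    · exact ⟨β, B, e, hv⟩
  · rintro ⟨β, B, e, hv⟩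
    exact Or.inr (Or.inr (Or.inr ⟨β, B, e, hv⟩))

theorem valid_disj {P : State} {C : Set (Formula T κ)} {h : WF C} :
    Valid P (disj C h) ↔ ∃ A ∈ C, Valid P A := by
  rw [disj, valid_neg, valid_conj]
  simp [valid_neg]

theorem NTS.Trans.smul {P P' : State} {α : Act} (h : T.Trans P α P') (π : NPerm 𝒩) :
    T.Trans (π • P) (π • α) (π • P') := by
  rw [NTS.Trans, T.bn_smul]
  exact T.tr_smul π _ _ _ _ h

/-- Validity is equivariant. -/
theorem Valid.smul {P : State} {A : Formula T κ} (h : Valid P A) (π : NPerm 𝒩) :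
    Valid (π • P) (π • A) := by
  suffices key : ∀ (A : Formula T κ) (π : NPerm 𝒩) (P : State),
      Valid P A ↔ Valid (π • P) (π • A) from (key A π P).1 h
  intro A
  -- Induction along `ImmSub` reaches the body of every representative of `⟨α⟩B`, as the existential
  -- in `valid_may` requires.
  induction A using immSub_wf.induction with
  | h A ih =>
    rcases exists_eq_constructor A with ⟨C, hC, rfl⟩ | ⟨B, rfl⟩ | ⟨φ, rfl⟩ | ⟨α, B, rfl⟩ <;>
      intro π P
    · rw [smul_conj, valid_conj, valid_conj]
      constructor
      · rintro hv _ ⟨A, hA, rfl⟩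
        exact (ih A (.conj hC hA) π P).1 (hv A hA)
      · exact fun hv A hA =>
          (ih A (.conj hC hA) π P).2 (hv _ (Set.smul_mem_smul_set hA))
    · rw [Formula.smul_neg, valid_neg, valid_neg, ih B (.neg B) π P]
    · rw [smul_pred, valid_pred, valid_pred]
      refine ⟨T.entails_smul π P φ, fun hv => ?_⟩
      simpa using T.entails_smul π⁻¹ _ _ hv
    · rw [valid_may, Formula.smul_may, valid_may]
      constructor
      · rintro ⟨β, D, e, hf, P', ht, hv⟩
        refine ⟨π • β, π • D, ?_, ?_, π • P', ht.smul π, ?_⟩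
        · rw [← Formula.smul_may, e, Formula.smul_may]
        · rw [T.bn_smul]; exact hf.smul π
        · exact (ih D (by rw [e]; exact .may β D) π P').1 hv
      · rintro ⟨β, D, e, hf, P', ht, hv⟩
        have e' : may α B = may (π⁻¹ • β) (π⁻¹ • D) := by
          rw [← Formula.smul_may, ← e, ← Formula.smul_may, inv_smul_smul]
        refine ⟨π⁻¹ • β, π⁻¹ • D, e', ?_, π⁻¹ • P', ?_, ?_⟩
        · rw [T.bn_smul, ← inv_smul_smul π P]; exact hf.smul π⁻¹
        · have := ht.smul π⁻¹
          rwa [inv_smul_smul] at this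
        · refine (ih (π⁻¹ • D) (by rw [e']; exact .may _ _) π _).2 ?_
          rwa [smul_inv_smul, smul_inv_smul]

theorem valid_smul_iff {P : State} {A : Formula T κ} (π : NPerm 𝒩) :
    Valid (π • P) (π • A) ↔ Valid P A :=
  ⟨fun h => by simpa using h.smul π⁻¹, fun h => h.smul π⟩

theorem valid_inv_smul_iff {P : State} {A : Formula T κ} (π : NPerm 𝒩) :
    Valid P (π⁻¹ • A) ↔ Valid (π • P) A := by
  rw [← valid_smul_iff π, smul_inv_smul]

theorem finSupp_of_nominal {X : Type u} [Nominal 𝒩 X] (x : X) : FinSupp 𝒩 x := Nominal.finSupp x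

/-- The binding names in a transition may be renamed. -/
theorem NTS.Trans.rename {P P' : State} {α : Act} (h : T.Trans P α P') {π : NPerm 𝒩}
    (hπ : ∀ a, a ∈ supp 𝒩 α ∨ a ∈ supp 𝒩 P' → a ∉ T.bn α → π • a = a) :
    T.Trans P (π • α) (π • P') := by
  have e : (NameAbs.mk (T.bn (π • α)) (π • α, π • P') : NameAbs 𝒩 (Act × State)) =
      NameAbs.mk (T.bn α) (α, P') := by
    refine (Quotient.sound (s := absSetoid 𝒩 (Act × State)) (a := (T.bn α, (α, P')))
      ⟨π, (T.bn_smul π α).symm, rfl, fun a ha hb => hπ a ?_ hb⟩).symm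
    exact supp_prod_subset (finSupp_of_nominal α) (finSupp_of_nominal P') ha
  rw [NTS.Trans, e]
  exact h

/-- A transition witnesses `⟨α⟩A`, even if its binding names are not fresh. -/
theorem valid_may_of_trans {P P' : State} {α : Act} {A : Formula T κ} (h : T.Trans P α P')
    (hA : Valid P' A) : Valid P (may α A) := by
  obtain ⟨π, h1, h2⟩ := exists_perm_fresh (T.bn α)
    (((supp_finite (finSupp_of_nominal (𝒩 := 𝒩) P)).union
      (supp_finite (finSupp_of_nominal (𝒩 := 𝒩) P'))).union
      ((supp_finite (finSupp_of_nominal (𝒩 := 𝒩) α)).union (supp_finite A.finSupp)))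
  refine valid_may.2 ⟨π • α, π • A, (may_smul_eq ?_).symm, ?_, π • P', h.rename ?_, hA.smul π⟩
  · rintro a (ha | ha) hb
    · exact h2 a (Or.inr (Or.inl ha)) hb
    · exact h2 a (Or.inr (Or.inr ha)) hb
  · rw [T.bn_smul]
    exact fresh_permFinset fun a ha h' => h1 a ha (Or.inl (Or.inl h'))
  · rintro a (ha | ha) hb
    · exact h2 a (Or.inr (Or.inl ha)) hb
    · exact h2 a (Or.inl (Or.inr ha)) hb

/-- Any representative of `⟨α⟩A` with fresh binding names can be used for validity. -/
theorem exists_trans_of_valid_may {P : State} {α : Act} {A : Formula T κ}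
    (hf : Fresh (T.bn α) P) (h : Valid P (may α A)) : ∃ P', T.Trans P α P' ∧ Valid P' A := by
  obtain ⟨β, B, e, hf', P', ht, hv⟩ := valid_may.1 h
  obtain ⟨ρ, rfl, rfl, hρ⟩ := may_eq_may.1 e
  -- The renaming `ρ` may move names of `P`. It is replaced by a `π` that acts in the same way on
  -- `α` and `A` but fixes `P`, since neither `bn α` nor its image under `ρ` meets `supp P`.
  obtain ⟨π, h1, h2⟩ := exists_perm_eqOn ρ (T.bn α)
  have key : ∀ a, a ∈ supp 𝒩 α ∨ a ∈ supp 𝒩 A → π • a = ρ • a := by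
    intro a ha
    by_cases hb : a ∈ T.bn α
    · exact h1 a hb
    · have e := hρ a ha hb
      rw [e]
      refine h2 a hb fun b hb' hba => hb ?_
      rwa [← smul_left_cancel ρ (hba.trans e.symm)]
  have eα : π • α = ρ • α :=
    smul_eq_smul_of_eqOn_supp (finSupp_of_nominal α) fun a ha => key a (Or.inl ha)
  have eA : π • A = ρ • A := smul_eq_smul_of_eqOn_supp A.finSupp fun a ha => key a (Or.inr ha)
  have eP : π • P = P := by
    refine smul_eq_of_fixes_supp (finSupp_of_nominal P) fun a ha => h2 a (fun h => hf a h ha) ?_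
    rintro b hb rfl
    exact hf' _ (by rw [T.bn_smul]; exact smul_mem_permFinset.2 hb) ha
  rw [← eα] at ht
  rw [← eA] at hv
  refine ⟨π⁻¹ • P', ?_, by simpa using hv.smul π⁻¹⟩
  have := ht.smul π⁻¹
  rwa [inv_smul_smul, inv_smul_eq_iff.2 eP.symm] at this

end Formulas

/-! ### Equivariance of weak formulas and of weak transitions. -/

section Weak

variable {𝒩 : Type u} [Names 𝒩] {State Pred Act : Type u}
  [Nominal 𝒩 State] [Nominal 𝒩 Pred] [Nominal 𝒩 Act]
  {T : WeakNTS 𝒩 State Pred Act} {κ : Cardinal.{u}}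

open Formula

namespace Formula

theorem smul_disj (π : NPerm 𝒩) (C : Set (Formula T.toNTS κ)) (h : WF C) :
    π • disj C h = disj (π • C) (h.smul π) := by
  rw [disj, disj, Formula.smul_neg, Formula.neg_inj, smul_conj, conj_inj, ← Set.image_smul,
    ← Set.image_smul, Set.image_image, Set.image_image]
  exact Set.image_congr fun A _ => Formula.smul_neg π A

theorem disj_congr {C D : Set (Formula T.toNTS κ)} (hC : WF C) (hD : WF D) (h : C = D) :
    disj C hC = disj D hD := by subst h; rfl

variable [hκ : Fact (ℵ₀ < κ)]

theorem smul_wmayTau (π : NPerm 𝒩) (A : Formula T.toNTS κ) :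
    π • wmayTau A = wmayTau (π • A) := by
  rw [wmayTau, smul_disj]
  refine disj_congr _ _ ?_
  rw [← Set.image_smul, ← Set.range_comp]
  exact congrArg Set.range (funext fun i => smul_tauPow π A i)

theorem supp_wmayTau_subset (A : Formula T.toNTS κ) : supp 𝒩 (wmayTau A) ⊆ supp 𝒩 A :=
  supp_subset (supp_finite A.finSupp) fun π hπ => by
    rw [smul_wmayTau, smul_eq_of_fixes_supp A.finSupp fun a ha => hπ ha]

theorem smul_eq_tau_iff (π : NPerm 𝒩) (α : Act) : π • α = T.τ ↔ α = T.τ := by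
  rw [smul_eq_iff_eq_inv_smul, T.τ_smul]

theorem wmay_tau (A : Formula T.toNTS κ) : wmay T.τ A = wmayTau A := if_pos rfl

theorem wmay_of_ne {α : Act} (h : α ≠ T.τ) (A : Formula T.toNTS κ) :
    wmay α A = wmayTau (may α (wmayTau A)) := if_neg h

theorem smul_wmay (π : NPerm 𝒩) (α : Act) (A : Formula T.toNTS κ) :
    π • wmay α A = wmay (π • α) (π • A) := by
  by_cases h : α = T.τ
  · rw [h, T.τ_smul, wmay_tau, wmay_tau, smul_wmayTau]
  · rw [wmay_of_ne h, wmay_of_ne (mt (smul_eq_tau_iff π α).1 h), smul_wmayTau, smul_may,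
      smul_wmayTau]

theorem smul_and (π : NPerm 𝒩) (A B : Formula T.toNTS κ) :
    π • A.and B = (π • A).and (π • B) := by
  rw [Formula.and, smul_conj, Formula.and, conj_inj, ← Set.image_smul, Set.image_pair]

/-- The set of weak formulas is equivariant. -/
theorem IsWeak.smul {A : Formula T.toNTS κ} (h : A.IsWeak) (π : NPerm 𝒩) : (π • A).IsWeak := by
  induction h with
  | conj C h hC ih =>
    rw [smul_conj]
    refine .conj _ _ ?_
    rintro _ ⟨A, hA, rfl⟩
    exact ih A hA
  | neg A hA ih => rw [Formula.smul_neg]; exact .neg _ ih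
  | wmay α A hA ih => rw [smul_wmay]; exact .wmay _ _ ih
  | wmayPred A φ hA ih =>
    rw [smul_wmay, smul_and, smul_pred, T.τ_smul]; exact .wmayPred _ _ ih

theorem IsWeak.disj {C : Set (Formula T.toNTS κ)} (h : WF C) (hC : ∀ A ∈ C, A.IsWeak) :
    (disj C h).IsWeak := by
  refine .neg _ (.conj _ _ ?_)
  rintro _ ⟨A, hA, rfl⟩
  exact .neg _ (hC A hA)

end Formula

/-- The names in `bn τ` lie in `supp τ`, which is empty; so `τ`-steps never require renaming. -/
theorem WeakNTS.fresh_bn_tau (P : State) : Fresh (T.bn T.τ) P := fun a ha => by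
  have h : supp 𝒩 T.τ ⊆ ∅ := supp_subset Set.finite_empty fun π _ => T.τ_smul π
  exact absurd (h (T.bn_subset _ a ha)) (Set.notMem_empty a)

theorem WeakNTS.TauStar.smul {P P' : State} (h : T.TauStar P P') (π : NPerm 𝒩) :
    T.TauStar (π • P) (π • P') := by
  refine Relation.ReflTransGen.lift (fun P : State => π • P) (fun P P' ht => ?_) _ _ h
  have := NTS.Trans.smul ht π
  rwa [T.τ_smul] at this

theorem WeakNTS.HTrans.smul {P P' : State} {α : Act} (h : T.HTrans P α P') (π : NPerm 𝒩) :
    T.HTrans (π • P) (π • α) (π • P') := by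
  refine h.imp (fun h => ⟨(smul_eq_tau_iff π α).2 h.1, h.2.smul π⟩) fun h =>
    ⟨mt (smul_eq_tau_iff π α).1 h.1, ?_⟩
  obtain ⟨-, P₁, P₂, h1, h2, h3⟩ := h
  exact ⟨π • P₁, π • P₂, h1.smul π, NTS.Trans.smul h2 π, h3.smul π⟩

theorem WeakNTS.hTrans_of_trans {P P' : State} {α : Act} (h : T.Trans P α P') :
    T.HTrans P α P' := by
  by_cases hα : α = T.τ
  · subst hα; exact Or.inl ⟨rfl, .single h⟩
  · exact Or.inr ⟨hα, P, P', .refl, h, .refl⟩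

theorem WeakNTS.TauStar.trans_hTrans {P P' P'' : State} {α : Act} (h : T.TauStar P P')
    (h' : T.HTrans P' α P'') : T.HTrans P α P'' := by
  refine h'.imp (fun h' => ⟨h'.1, h.trans h'.2⟩) fun h' => ⟨h'.1, ?_⟩
  obtain ⟨-, P₁, P₂, h1, h2, h3⟩ := h'
  exact ⟨P₁, P₂, h.trans h1, h2, h3⟩

theorem WeakNTS.HTrans.trans_tauStar {P P' P'' : State} {α : Act} (h : T.HTrans P α P')
    (h' : T.TauStar P' P'') : T.HTrans P α P'' := by
  refine h.imp (fun h => ⟨h.1, h.2.trans h'⟩) fun h => ⟨h.1, ?_⟩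
  obtain ⟨-, P₁, P₂, h1, h2, h3⟩ := h
  exact ⟨P₁, P₂, h1, h2, h3.trans h'⟩

/-! ### Validity of the weak modalities. -/

section Validity

variable [hκ : Fact (ℵ₀ < κ)]

theorem valid_and {P : State} {A B : Formula T.toNTS κ} :
    Valid P (A.and B) ↔ Valid P A ∧ Valid P B := by
  rw [Formula.and, valid_conj]
  simp

theorem valid_wmayTau {P : State} {A : Formula T.toNTS κ} :
    Valid P (wmayTau A) ↔ ∃ P', T.TauStar P P' ∧ Valid P' A := by
  rw [wmayTau, valid_disj]
  constructor
  · rintro ⟨_, ⟨i, rfl⟩, hv⟩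
    induction i generalizing P with
    | zero => exact ⟨P, .refl, hv⟩
    | succ i ih =>
      obtain ⟨P₁, ht, hv'⟩ := exists_trans_of_valid_may (T.fresh_bn_tau P) hv
      obtain ⟨P', h, hA⟩ := ih hv'
      exact ⟨P', .head ht h, hA⟩
  · rintro ⟨P', h, hA⟩
    induction h using Relation.ReflTransGen.head_induction_on with
    | refl => exact ⟨_, ⟨0, rfl⟩, hA⟩
    | head ht _ ih =>
      obtain ⟨_, ⟨i, rfl⟩, hv⟩ := ih
      exact ⟨_, ⟨i + 1, rfl⟩, valid_may_of_trans ht hv⟩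

theorem valid_wmay_of_hTrans {P P' : State} {α : Act} {A : Formula T.toNTS κ}
    (h : T.HTrans P α P') (hA : Valid P' A) : Valid P (wmay α A) := by
  rcases h with ⟨rfl, h⟩ | ⟨hα, P₁, P₂, h1, h2, h3⟩
  · rw [wmay_tau, valid_wmayTau]; exact ⟨P', h, hA⟩
  · rw [wmay_of_ne hα, valid_wmayTau]
    exact ⟨P₁, h1, valid_may_of_trans h2 (valid_wmayTau.2 ⟨P', h3, hA⟩)⟩

/-- The names in `bn α` are fresh for `P` but perhaps not for the state `P₁` at which `α` is
performed. A permutation that fixes `P` and `⟨α⟩⟨⟨τ⟩⟩A` replaces `P₁` by `π⁻¹ • P₁`, for which they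
are fresh and which `P` still reaches. -/
theorem exists_hTrans_of_valid_wmay {P : State} {α : Act} {A : Formula T.toNTS κ}
    (hf : Fresh (T.bn α) P) (h : Valid P (wmay α A)) : ∃ P', T.HTrans P α P' ∧ Valid P' A := by
  by_cases hα : α = T.τ
  · subst hα
    rw [wmay_tau, valid_wmayTau] at h
    obtain ⟨P', h, hA⟩ := h
    exact ⟨P', Or.inl ⟨rfl, h⟩, hA⟩
  · rw [wmay_of_ne hα, valid_wmayTau] at h
    obtain ⟨P₁, h1, hv⟩ := h
    obtain ⟨π, hπ, hπ'⟩ := exists_perm_fresh (T.bn α)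
      (((supp_finite (finSupp_of_nominal (𝒩 := 𝒩) P)).union
        (supp_finite (finSupp_of_nominal (𝒩 := 𝒩) P₁))).union
        ((supp_finite (finSupp_of_nominal (𝒩 := 𝒩) α)).union (supp_finite A.finSupp)))
    have eP : π⁻¹ • P = P := by
      rw [inv_smul_eq_iff]
      exact (smul_eq_of_fixes_supp (finSupp_of_nominal P) fun a ha =>
        hπ' a (Or.inl (Or.inl ha)) fun h => hf a h ha).symm
    have eA : may α (wmayTau A) = π • may α (wmayTau A) := by
      rw [Formula.smul_may]
      refine (may_smul_eq ?_).symm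
      rintro a (ha | ha) hb
      · exact hπ' a (Or.inr (Or.inl ha)) hb
      · exact hπ' a (Or.inr (Or.inr (supp_wmayTau_subset A ha))) hb
    have hv' : Valid (π⁻¹ • P₁) (may α (wmayTau A)) := by
      rw [← valid_smul_iff π, smul_inv_smul, ← eA]; exact hv
    have hf' : Fresh (T.bn α) (π⁻¹ • P₁) := fun a ha ha' =>
      hπ a ha (Or.inl (Or.inr (by simpa using mem_supp_smul ha')))
    obtain ⟨P₂, ht, hv''⟩ := exists_trans_of_valid_may hf' hv'
    obtain ⟨P', h3, hA⟩ := valid_wmayTau.1 hv''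
    refine ⟨P', Or.inr ⟨hα, π⁻¹ • P₁, P₂, ?_, ht, h3⟩, hA⟩
    have := h1.smul π⁻¹
    rwa [eP] at this

end Validity

/-! ### Weak bisimilarity implies weak logical equivalence -/

theorem WeakNTS.WeakBisim.symm {P Q : State} (h : T.WeakBisim P Q) : T.WeakBisim Q P := by
  obtain ⟨R, hR, h⟩ := h
  exact ⟨R, hR, hR.1 _ _ h⟩

theorem WeakNTS.WeakBisim.simulate {P Q P' : State} {α : Act} (h : T.WeakBisim P Q)
    (hf : Fresh (T.bn α) Q) (ht : T.Trans P α P') :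
    ∃ Q', T.HTrans Q α Q' ∧ T.WeakBisim P' Q' := by
  obtain ⟨R, hR, h⟩ := h
  obtain ⟨Q', h1, h2⟩ := hR.2.1 _ _ h α P' hf ht
  exact ⟨Q', h1, R, hR, h2⟩

theorem WeakNTS.WeakBisim.entails {P Q : State} {φ : Pred} (h : T.WeakBisim P Q)
    (hφ : T.entails P φ) : ∃ Q', T.TauStar Q Q' ∧ T.entails Q' φ ∧ T.WeakBisim P Q' := by
  obtain ⟨R, hR, h⟩ := h
  obtain ⟨Q', h1, h2, h3⟩ := hR.2.2 _ _ h φ hφ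
  exact ⟨Q', h1, h2, R, hR, h3⟩

theorem WeakNTS.WeakBisim.tauStar {P Q P' : State} (h : T.WeakBisim P Q)
    (ht : T.TauStar P P') : ∃ Q', T.TauStar Q Q' ∧ T.WeakBisim P' Q' := by
  induction ht with
  | refl => exact ⟨Q, .refl, h⟩
  | tail _ ht ih =>
    obtain ⟨Q₁, h1, h2⟩ := ih
    obtain ⟨Q', h3 | h3, h4⟩ := h2.simulate (T.fresh_bn_tau Q₁) ht
    · exact ⟨Q', h1.trans h3.2, h4⟩
    · exact absurd rfl h3.1

/-- Weak bisimilarity is equivariant. -/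
theorem WeakNTS.WeakBisim.smul {P Q : State} (h : T.WeakBisim P Q) (π : NPerm 𝒩) :
    T.WeakBisim (π • P) (π • Q) := by
  obtain ⟨R, ⟨hsym, hsim, hstat⟩, h⟩ := h
  refine ⟨fun P Q => R (π⁻¹ • P) (π⁻¹ • Q), ⟨fun P Q h => hsym _ _ h, ?_, ?_⟩, by simpa using h⟩
  · intro P Q h α P' hf ht
    obtain ⟨Q', h1, h2⟩ := hsim _ _ h (π⁻¹ • α) (π⁻¹ • P')
      (by rw [T.bn_smul]; exact hf.smul π⁻¹) (NTS.Trans.smul ht π⁻¹)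
    exact ⟨π • Q', by simpa using h1.smul π, by simpa using h2⟩
  · intro P Q h φ hφ
    obtain ⟨Q', h1, h2, h3⟩ := hstat _ _ h (π⁻¹ • φ) (T.entails_smul π⁻¹ _ _ hφ)
    exact ⟨π • Q', by simpa using h1.smul π, by simpa using T.entails_smul π _ _ h2,
      by simpa using h3⟩

variable [hκ : Fact (ℵ₀ < κ)]

theorem WeakNTS.WeakBisim.weakEquiv {P Q : State} (h : T.WeakBisim P Q) :
    WeakEquiv T κ P Q := by
  suffices key : ∀ A : Formula T.toNTS κ, A.IsWeak →
      ∀ P Q, T.WeakBisim P Q → Valid P A → Valid Q A from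
    fun A hA => ⟨key A hA P Q h, key A hA Q P h.symm⟩
  intro A hA
  induction hA with
  | conj C h hC ih =>
    intro P Q hPQ hv
    rw [valid_conj] at hv ⊢
    exact fun A hA => ih A hA P Q hPQ (hv A hA)
  | neg A hA ih =>
    intro P Q hPQ hv
    rw [valid_neg] at hv ⊢
    exact fun h => hv (ih Q P hPQ.symm h)
  | wmay α A hA ih =>
    intro P Q hPQ hv
    by_cases hα : α = T.τ
    · subst hα
      rw [wmay_tau, valid_wmayTau] at hv ⊢
      obtain ⟨P', h1, h2⟩ := hv
      obtain ⟨Q', h3, h4⟩ := hPQ.tauStar h1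
      exact ⟨Q', h3, ih _ _ h4 h2⟩
    · rw [wmay_of_ne hα, valid_wmayTau] at hv
      obtain ⟨P₁, hP₁, hv⟩ := hv
      obtain ⟨Q₁, hQ₁, hPQ₁⟩ := hPQ.tauStar hP₁
      -- The renamed binders must be fresh for `P₁`, to extract a transition, and for `Q₁`, to
      -- simulate it.
      obtain ⟨π, hπ, hπ'⟩ := exists_perm_fresh (T.bn α)
        (((supp_finite (finSupp_of_nominal (𝒩 := 𝒩) P₁)).union
          (supp_finite (finSupp_of_nominal (𝒩 := 𝒩) Q₁))).union
          ((supp_finite (finSupp_of_nominal (𝒩 := 𝒩) α)).union (supp_finite A.finSupp)))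
      have eA : may (π • α) (wmayTau (π • A)) = may α (wmayTau A) := by
        rw [← smul_wmayTau]
        refine may_smul_eq ?_
        rintro a (ha | ha) hb
        · exact hπ' a (Or.inr (Or.inl ha)) hb
        · exact hπ' a (Or.inr (Or.inr (supp_wmayTau_subset A ha))) hb
      have eW : wmay (π • α) (π • A) = wmay α A := by
        rw [wmay_of_ne hα, wmay_of_ne (mt (smul_eq_tau_iff π α).1 hα), eA]
      have hfP : Fresh (T.bn (π • α)) P₁ := by
        rw [T.bn_smul]; exact fresh_permFinset fun a ha h => hπ a ha (Or.inl (Or.inl h))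
      have hfQ : Fresh (T.bn (π • α)) Q₁ := by
        rw [T.bn_smul]; exact fresh_permFinset fun a ha h => hπ a ha (Or.inl (Or.inr h))
      rw [← eA] at hv
      obtain ⟨P₂, ht, hv⟩ := exists_trans_of_valid_may hfP hv
      obtain ⟨P', hP', hv⟩ := valid_wmayTau.1 hv
      obtain ⟨Q₂, hQ₂, hPQ₂⟩ := hPQ₁.simulate hfQ ht
      obtain ⟨Q', hQ', hPQ'⟩ := hPQ₂.tauStar hP'
      rw [← eW]
      refine valid_wmay_of_hTrans (hQ₁.trans_hTrans (hQ₂.trans_tauStar hQ')) ?_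
      -- The induction hypothesis concerns `A`, not `π • A`, so it is applied to the states moved
      -- back by `π⁻¹`.
      have hvA : Valid (π⁻¹ • P') A := by simpa using hv.smul π⁻¹
      simpa using (ih _ _ (hPQ'.smul π⁻¹) hvA).smul π
  | wmayPred A φ hA ih =>
    intro P Q hPQ hv
    rw [wmay_tau, valid_wmayTau] at hv ⊢
    obtain ⟨P', h1, h2⟩ := hv
    rw [valid_and, valid_pred] at h2
    obtain ⟨Q₁, h3, h4⟩ := hPQ.tauStar h1
    obtain ⟨Q', h5, h6, h7⟩ := h4.entails h2.2
    -- Static implication yields a state that satisfies `φ` and is still bisimilar to `P'`, so both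
    -- conjuncts hold at the same state.
    exact ⟨Q', h3.trans h5, valid_and.2 ⟨ih _ _ h7 h2.1, valid_pred.2 h6⟩⟩

end Weak

/-! ### Well-formedness from a common support bound; equivariance of the conjuncts of `D(P,Q)`. -/

section Weak

variable {𝒩 : Type u} [Names 𝒩] {State Pred Act : Type u}
  [Nominal 𝒩 State] [Nominal 𝒩 Pred] [Nominal 𝒩 Act]
  {T : WeakNTS 𝒩 State Pred Act} {κ : Cardinal.{u}}

open Formula

theorem Formula.wf_of_supp_subset {C : Set (Formula T.toNTS κ)} (hC : #C < κ) {N : Set 𝒩}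
    (hN : N.Finite) (h : ∀ A ∈ C, supp 𝒩 A ⊆ N) : WF C :=
  ⟨hC, N, hN, supports_set_of_supp_subset (fun A _ => A.finSupp) h⟩

theorem Formula.supp_conj_subset_of_forall {C : Set (Formula T.toNTS κ)} {hC : WF C} {N : Set 𝒩}
    (hN : N.Finite) (h : ∀ A ∈ C, supp 𝒩 A ⊆ N) : supp 𝒩 (conj C hC) ⊆ N :=
  supp_conj_subset hN (supports_set_of_supp_subset (fun A _ => A.finSupp) h)

theorem supp_state_finite (P : State) : (supp 𝒩 P).Finite := supp_finite (finSupp_of_nominal P)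

theorem supp_inv_smul_subset {X Y : Type u} [MulAction (NPerm 𝒩) X] [MulAction (NPerm 𝒩) Y]
    {x : X} {y : Y} {π : NPerm 𝒩} (h : supp 𝒩 x ⊆ supp 𝒩 (π • y)) :
    supp 𝒩 (π⁻¹ • x) ⊆ supp 𝒩 y := fun a ha => by
  have h1 := h (mem_supp_smul ha)
  simpa using mem_supp_smul h1

theorem smul_distSet_subset (B : State → State → Formula T.toNTS κ) (π : NPerm 𝒩) (P Q : State) :
    π • distSet B P Q ⊆ distSet B (π • P) (π • Q) := by
  rintro _ ⟨_, ⟨ρ, rfl⟩, rfl⟩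
  -- The permutations are reindexed by `ρ ↦ ρ * π⁻¹`; nothing is required of `B`.
  exact ⟨ρ * π⁻¹, by simp [mul_smul]⟩

theorem smul_distSet (B : State → State → Formula T.toNTS κ) (π : NPerm 𝒩) (P Q : State) :
    π • distSet B P Q = distSet B (π • P) (π • Q) := by
  refine (smul_distSet_subset B π P Q).antisymm ?_
  rw [Set.subset_smul_set_iff]
  simpa using smul_distSet_subset B π⁻¹ (π • P) (π • Q)

variable [hκ : Fact (ℵ₀ < κ)]

theorem mk_lt_of_countable {X : Type u} {C : Set X} (h : C.Countable) : #C < κ :=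
  (Cardinal.mk_le_aleph0_iff.2 h.to_subtype).trans_lt hκ.out

/-! ### Weak logical equivalence is a weak bisimulation -/

theorem WeakEquiv.symm {P Q : State} (h : WeakEquiv T κ P Q) : WeakEquiv T κ Q P :=
  fun A hA => (h A hA).symm

theorem WeakEquiv.smul {P Q : State} (h : WeakEquiv T κ P Q) (π : NPerm 𝒩) :
    WeakEquiv T κ (π • P) (π • Q) := fun A hA => by
  rw [← valid_inv_smul_iff, ← valid_inv_smul_iff]
  exact h _ (hA.smul π⁻¹)

theorem not_weakEquiv_smul {P Q : State} (h : ¬ WeakEquiv T κ P Q) (π : NPerm 𝒩) :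
    ¬ WeakEquiv T κ (π • P) (π • Q) := fun h' => h (by simpa using h'.smul π⁻¹)

theorem exists_isDistinguishingWeak {P Q : State} (h : ¬ WeakEquiv T κ P Q) :
    ∃ A : Formula T.toNTS κ, IsDistinguishingWeak T P Q A := by
  rw [WeakEquiv] at h
  push Not at h
  obtain ⟨A, hA, ⟨h1, h2⟩ | ⟨h1, h2⟩⟩ := h
  · exact ⟨A, hA, h1, h2⟩
  · exact ⟨neg A, .neg A hA, valid_neg.2 h1, fun h => valid_neg.1 h h2⟩

/-- This supplies the default value that `choose!` uses outside the relevant states. -/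
instance : Nonempty (Formula T.toNTS κ) :=
  ⟨conj ∅ (wf_of_supp_subset (mk_lt_of_countable Set.countable_empty) Set.finite_empty (by simp))⟩

/-- States that are not weakly logically equivalent have a distinguishing weak formula with no
more names than the first state. -/
theorem exists_isDistinguishingWeak_supp_subset {P Q : State} (h : ¬ WeakEquiv T κ P Q) :
    ∃ A : Formula T.toNTS κ, IsDistinguishingWeak T P Q A ∧ supp 𝒩 A ⊆ supp 𝒩 P := by
  obtain ⟨A, hA, hP, hQ⟩ := exists_isDistinguishingWeak h
  -- The conjunction of the `F`-orbit of `A` has the required support, since `F` is closed under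
  -- products. It holds at `P`, which `F` fixes, and fails at `Q`, since `1 ∈ F` gives the conjunct
  -- `A`.
  let F : Set (NPerm 𝒩) := {π | ∀ a ∈ supp 𝒩 P, π • a = a}
  have hs : MulAction.Supports (NPerm 𝒩) (supp 𝒩 P) ((fun π : NPerm 𝒩 => π • A) '' F) := by
    refine smul_set_subset_supports ?_
    rintro π hπ _ ⟨ρ, hρ, rfl⟩
    exact ⟨π * ρ, fun a ha => by rw [mul_smul, hρ a ha, hπ a ha], mul_smul π ρ A⟩
  have hw : WF ((fun π : NPerm 𝒩 => π • A) '' F) :=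
    ⟨mk_lt_of_countable (F.to_countable.image _), _, supp_state_finite P, hs⟩
  refine ⟨conj _ hw, ⟨.conj _ _ ?_, ?_, fun hv => hQ ?_⟩,
    supp_conj_subset (supp_state_finite P) hs⟩
  · rintro _ ⟨π, -, rfl⟩
    exact hA.smul π
  · rw [valid_conj]
    rintro _ ⟨π, hπ, rfl⟩
    have := hP.smul π
    rwa [smul_eq_of_fixes_supp (finSupp_of_nominal P) hπ] at this
  · exact valid_conj.1 hv A ⟨1, fun a _ => one_smul _ a, one_smul _ A⟩

/-- A weak formula that holds for `P` and for none of the states in `S`, if no state in `S` is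
weakly logically equivalent to `P`. -/
theorem exists_isWeak_separating (hcard : #State < κ) (P : State) (S : Set State)
    (hS : ∀ Q ∈ S, ¬ WeakEquiv T κ P Q) :
    ∃ A : Formula T.toNTS κ, A.IsWeak ∧ Valid P A ∧ ∀ Q ∈ S, ¬ Valid Q A := by
  choose! f hf using fun Q (hQ : Q ∈ S) => exists_isDistinguishingWeak_supp_subset (hS Q hQ)
  have hw : WF (f '' S) := by
    -- All chosen supports lie in `supp P`, so `S` itself need not be finitely supported.
    refine wf_of_supp_subset ((Cardinal.mk_image_le.trans (Cardinal.mk_set_le S)).trans_lt hcard)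
      (supp_state_finite P) ?_
    rintro _ ⟨Q, hQ, rfl⟩
    exact (hf Q hQ).2
  refine ⟨conj _ hw, .conj _ _ ?_, valid_conj.2 ?_, fun Q hQ hv => (hf Q hQ).1.2.2 ?_⟩
  · rintro _ ⟨Q, hQ, rfl⟩
    exact (hf Q hQ).1.1
  · rintro _ ⟨Q, hQ, rfl⟩
    exact (hf Q hQ).1.2.1
  · exact valid_conj.1 hv _ ⟨Q, hQ, rfl⟩

/-- If a clause failed, one formula `A` would separate the left-hand state from all candidate
answers of `Q` at once. Then `⟨⟨α⟩⟩A`, or `⟨⟨τ⟩⟩(A ∧ φ)` in the static case, would distinguish `P`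
from `Q`. -/
theorem isWeakBisimulation_weakEquiv (hcard : #State < κ) :
    T.IsWeakBisimulation (WeakEquiv T κ) := by
  refine ⟨fun _ _ h => h.symm, fun P Q hPQ α P' hf ht => ?_, fun P Q hPQ φ hφ => ?_⟩
  · by_contra! hne
    obtain ⟨A, hA, hP, hQ⟩ := exists_isWeak_separating hcard P' {Q' | T.HTrans Q α Q'} hne
    have hv : Valid Q (wmay α A) := (hPQ _ (.wmay α A hA)).1
      (valid_wmay_of_hTrans (WeakNTS.hTrans_of_trans ht) hP)
    obtain ⟨Q', h1, h2⟩ := exists_hTrans_of_valid_wmay hf hv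
    exact hQ Q' h1 h2
  · by_contra! hne
    obtain ⟨A, hA, hP, hQ⟩ := exists_isWeak_separating hcard P
      {Q' | T.TauStar Q Q' ∧ T.entails Q' φ} fun Q' h => hne Q' h.1 h.2
    have hv : Valid Q (wmay T.τ (A.and (pred φ))) := by
      refine (hPQ _ (.wmayPred A φ hA)).1 ?_
      rw [wmay_tau, valid_wmayTau]
      exact ⟨P, .refl, valid_and.2 ⟨hP, valid_pred.2 hφ⟩⟩
    rw [wmay_tau, valid_wmayTau] at hv
    obtain ⟨Q', h1, h2⟩ := hv
    rw [valid_and, valid_pred] at h2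
    exact hQ Q' ⟨h1, h2.2⟩ h2.1

/-- Weak bisimilarity coincides with weak logical equivalence. -/
theorem weakBisim_iff_weakEquiv (hcard : #State < κ) {P Q : State} :
    T.WeakBisim P Q ↔ WeakEquiv T κ P Q :=
  ⟨fun h => h.weakEquiv, fun h => ⟨_, isWeakBisimulation_weakEquiv hcard, h⟩⟩

/-! ### Characteristic formulas -/

theorem exists_isDistinguishingChoice :
    ∃ B : State → State → Formula T.toNTS κ, IsDistinguishingChoice T B := by
  choose! B hB using fun (P Q : State) (h : ¬ WeakEquiv T κ P Q) =>
    exists_isDistinguishingWeak_supp_subset h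
  exact ⟨B, hB⟩

namespace IsDistinguishingChoice

variable {B : State → State → Formula T.toNTS κ}

/-- The support of `B (π • P) (π • Q)` lies in that of `π • P`, and `π⁻¹` carries it back into `supp
P`. -/
theorem supp_subset_of_mem_distSet (hB : IsDistinguishingChoice T B)
    {P Q : State} (h : ¬ WeakEquiv T κ P Q) :
    ∀ A ∈ distSet B P Q, supp 𝒩 A ⊆ supp 𝒩 P := by
  rintro _ ⟨π, rfl⟩
  exact supp_inv_smul_subset (hB _ _ (not_weakEquiv_smul h π)).2

theorem wf_distSet (hB : IsDistinguishingChoice T B)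
    {P Q : State} (h : ¬ WeakEquiv T κ P Q) : WF (distSet B P Q) :=
  wf_of_supp_subset (mk_lt_of_countable (Set.countable_range _)) (supp_state_finite P)
    (hB.supp_subset_of_mem_distSet h)

theorem wf_charSet (hB : IsDistinguishingChoice T B) (hcard : #State < κ)
    (hD : ∀ P Q, ¬ WeakEquiv T κ P Q → WF (distSet B P Q)) (P : State) :
    WF (charSet B hD P) := by
  refine wf_of_supp_subset (lt_of_le_of_lt ?_ hcard) (supp_state_finite P) ?_
  · let f : {Q // ¬ WeakEquiv T κ P Q} → Formula T.toNTS κ := fun Q => conj _ (hD P Q.1 Q.2)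
    have e : charSet B hD P = Set.range f := by
      ext A
      constructor
      · rintro ⟨Q, h, rfl⟩; exact ⟨⟨Q, h⟩, rfl⟩
      · rintro ⟨⟨Q, h⟩, rfl⟩; exact ⟨Q, h, rfl⟩
    rw [e]
    exact Cardinal.mk_range_le.trans (Cardinal.mk_subtype_le _)
  · rintro _ ⟨Q, h, rfl⟩
    exact supp_conj_subset_of_forall (supp_state_finite P) (hB.supp_subset_of_mem_distSet h)

theorem isWeak_charFormula (hB : IsDistinguishingChoice T B)
    (hD : ∀ P Q, ¬ WeakEquiv T κ P Q → WF (distSet B P Q))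
    (hC : ∀ P, WF (charSet B hD P)) (P : State) : (charFormula B hD hC P).IsWeak := by
  refine .conj _ _ ?_
  rintro _ ⟨Q, h, rfl⟩
  refine .conj _ _ ?_
  rintro _ ⟨π, rfl⟩
  exact (hB _ _ (not_weakEquiv_smul h π)).1.1.smul π⁻¹

theorem valid_charFormula_self (hB : IsDistinguishingChoice T B)
    (hD : ∀ P Q, ¬ WeakEquiv T κ P Q → WF (distSet B P Q))
    (hC : ∀ P, WF (charSet B hD P)) (P : State) : Valid P (charFormula B hD hC P) := by
  rw [charFormula, valid_conj]
  rintro _ ⟨Q, h, rfl⟩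
  rw [valid_conj]
  rintro _ ⟨π, rfl⟩
  exact (valid_inv_smul_iff π).2 (hB _ _ (not_weakEquiv_smul h π)).1.2.1

theorem valid_charFormula_iff (hB : IsDistinguishingChoice T B)
    (hD : ∀ P Q, ¬ WeakEquiv T κ P Q → WF (distSet B P Q))
    (hC : ∀ P, WF (charSet B hD P)) (P Q : State) :
    Valid Q (charFormula B hD hC P) ↔ WeakEquiv T κ P Q := by
  refine ⟨fun hv => ?_, fun h => (h _ (hB.isWeak_charFormula hD hC P)).1
    (hB.valid_charFormula_self hD hC P)⟩
  by_contra h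
  rw [charFormula, valid_conj] at hv
  -- The conjunct of `D(P,Q)` at the identity permutation is `B P Q`, which fails at `Q`.
  have h1 := valid_conj.1 (hv _ ⟨Q, h, rfl⟩) _ ⟨1, rfl⟩
  refine (hB P Q h).1.2.2 ?_
  simpa using h1

end IsDistinguishingChoice

theorem smul_charSet_subset (B : State → State → Formula T.toNTS κ)
    (hD : ∀ P Q, ¬ WeakEquiv T κ P Q → WF (distSet B P Q)) (π : NPerm 𝒩) (P : State) :
    π • charSet B hD P ⊆ charSet B hD (π • P) := by
  rintro _ ⟨_, ⟨Q, h, rfl⟩, rfl⟩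
  refine ⟨π • Q, not_weakEquiv_smul h π, ?_⟩
  change π • conj _ _ = _
  rw [smul_conj, conj_inj, smul_distSet]

/-- Characteristic formulas are equivariant. -/
theorem smul_charFormula (B : State → State → Formula T.toNTS κ)
    (hD : ∀ P Q, ¬ WeakEquiv T κ P Q → WF (distSet B P Q)) (hC : ∀ P, WF (charSet B hD P))
    (π : NPerm 𝒩) (P : State) : π • charFormula B hD hC P = charFormula B hD hC (π • P) := by
  rw [charFormula, smul_conj, charFormula, conj_inj]
  refine (smul_charSet_subset B hD π P).antisymm ?_
  rw [Set.subset_smul_set_iff]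
  simpa using smul_charSet_subset B hD π⁻¹ (π • P)

end Weak

end NomTS

theorem mainTheorem7 {𝒩 : Type u} [Names 𝒩] {State Pred Act : Type u}
    [Nominal 𝒩 State] [Nominal 𝒩 Pred] [Nominal 𝒩 Act]
    (T : WeakNTS 𝒩 State Pred Act) (κ : Cardinal.{u}) [Fact (ℵ₀ < κ)] (hκ : #State < κ) :
    (∃ B : State → State → Formula T.toNTS κ, IsDistinguishingChoice T B) ∧
    ∀ B : State → State → Formula T.toNTS κ, IsDistinguishingChoice T B →
      ∃ (hD : ∀ P Q, ¬ WeakEquiv T κ P Q → Formula.WF (distSet B P Q))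
        (hC : ∀ P, Formula.WF (charSet B hD P)),
        (∀ P, IsCharacteristicWeak T P (charFormula B hD hC P)) ∧
        ∀ S : Set State, FinSupp 𝒩 S → (∀ P ∈ S, ∀ Q, T.WeakBisim P Q → Q ∈ S) →
          ∃ hS : Formula.WF (charFormula B hD hC '' S),
            (Formula.disj (charFormula B hD hC '' S) hS).IsWeak ∧
            ∀ P, P ∈ S ↔ Valid P (Formula.disj (charFormula B hD hC '' S) hS) := by
  refine ⟨exists_isDistinguishingChoice, fun B hB => ?_⟩
  have hD : ∀ P Q, ¬ WeakEquiv T κ P Q → Formula.WF (distSet B P Q) := fun P Q h =>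
    hB.wf_distSet h
  have hC := hB.wf_charSet hκ hD
  refine ⟨hD, hC, fun P => ⟨hB.isWeak_charFormula hD hC P, fun Q => ?_⟩, fun S hS hcl => ?_⟩
  · rw [hB.valid_charFormula_iff, weakBisim_iff_weakEquiv hκ]
  · have hw : Formula.WF (charFormula B hD hC '' S) := by
      obtain ⟨N, hN, hs⟩ := hS
      refine ⟨(Cardinal.mk_image_le.trans (Cardinal.mk_set_le S)).trans_lt hκ, N, hN,
        fun π hπ => ?_⟩
      -- As `Char` is equivariant, the set `N` that supports `S` also supports its image. The
      -- supports of the single `Char(P')` need not be bounded in common.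
      conv_rhs => rw [← hs π hπ]
      rw [← Set.image_smul, ← Set.image_smul, Set.image_image, Set.image_image]
      exact Set.image_congr fun P _ => smul_charFormula B hD hC π P
    refine ⟨hw, Formula.IsWeak.disj hw ?_, fun P => ?_⟩
    · rintro _ ⟨P, -, rfl⟩
      exact hB.isWeak_charFormula hD hC P
    · rw [valid_disj]
      constructor
      · exact fun hP => ⟨_, ⟨P, hP, rfl⟩, hB.valid_charFormula_self hD hC P⟩
      · rintro ⟨_, ⟨P', hP', rfl⟩, hv⟩
        rw [hB.valid_charFormula_iff] at hv
        -- Only here is closure of `S` under weak bisimilarity needed.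
        exact hcl P' hP' P ((weakBisim_iff_weakEquiv hκ).2 hv)
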